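/- Let $p$ be a prime, let $\mathbb{F}_q$ be a finite field of characteristic $p$ with $q$ elements, and let $0\le k\le 3$. Let $H_k(SL_2(\mathbb{F}_q),\mathbb{Z})$ denote the $k$-th homology group of the finite group $SL_2(\mathbb{F}_q)$ with coefficients in $\mathbb{Z}$ with trivial action, and let $H_k(SL_2(\mathbb{F}_q),\mathbb{Z})_{(p)}$ be its $p$-part, i.e. the subgroup of elements of $p$-power order (for $k\ge 1$ this is its Sylow $p$-subgroup). Then $$H_k(SL_2(\mathbb{F}_q),\mathbb{Z})_{(p)}\cong \mathbb{Z}/p$$ if $$(k,q)\in\{(1,2),(1,3),(2,4),(2,9),(3,2),(3,3),(3,4),(3,5),(3,8),(3,9),(3,27)\},$$ and $H_k(SL_2(\mathbb{F}_q),\mathbb{Z})_{(p)}=0$ for every other pair $(k,q)$ with $k\le 3$. -/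

import Mathlib

/-- Integral homology `H_k(G, ℤ)` of a group `G`: group homology with coefficients in `ℤ`
on which `G` acts trivially. -/
noncomputable abbrev integralHomology (G : Type) [Group G] (k : ℕ) : ModuleCat ℤ :=
  groupHomology (Rep.trivial ℤ G ℤ) k

/-- The `p`-part of `H_k(SL₂(F), ℤ)`: its subgroup of elements of `p`-power order. -/
noncomputable abbrev homologySL2PPart (p : ℕ) (F : Type) [Field F] (k : ℕ) :
    AddSubgroup (integralHomology (Matrix.SpecialLinearGroup (Fin 2) F) k) :=
  AddCommGroup.primaryComponent
    (integralHomology (Matrix.SpecialLinearGroup (Fin 2) F) k) p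

/-- The list of pairs `(k, q)` for which the `p`-part is nonzero. -/
def exceptionalPairs : Finset (ℕ × ℕ) :=
  {(1, 2), (1, 3), (2, 4), (2, 9), (3, 2), (3, 3), (3, 4), (3, 5), (3, 8), (3, 9), (3, 27)}

/-! Let q = p^f, G = SL₂(F), B the upper triangular and U the unipotent subgroup, and c_n the order
of the p-part of H_n(G, ℤ).

The group U is elementary abelian of index q² − 1, prime to p, and its integral homology has
exponent p in positive degrees. By transfer, the p-part of H_n(G, ℤ) is therefore just its
p-torsion. The Bockstein sequence of ℤ → ℤ → ℤ/p then gives c_{n+1} c_n = |H_{n+1}(G, ℤ/p)|, whose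
f-th power is |H_{n+1}(G, F)| because F ≅ (ℤ/p)^f additively. As c_0 = 1, these products determine
every c_n.

In positive degrees G and B have the same homology with coefficients in F (`borelEquiv`): the
functions on B\G split as the constants plus a Steinberg summand, which has no homology there.

For B there is an explicit minimal resolution of F. The space of functions F → F has a basis of
divided monomials indexed by base-p digits, on which the Hasse derivatives of orders 1, p, …,
p^(f−1) act as Jordan blocks of size p, one for each digit. The tensor product of the f complexes
alternating D and D^(p−1) resolves F, the torus acting in multidegree α through an additional twist
by the character t ↦ t^(weight α). Its terms are acyclic and its differentials vanish on
coinvariants, so |H_n(B, F)| = q^N(n) for n > 0, where N(n) counts the multidegrees of total degree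
n with q − 1 ∣ weight (`card_groupHomology_borel`). Hence c_{n+1} c_n = p^N(n+1)
(`card_homologySL2PPart_mul`).

What remains is arithmetic (`weightCount_cases`): in degrees at most 3 the weights are twice a sum
of at most three powers of p, and divisibility by q − 1 forces q to be one of a few small values,
for which N is computed. -/

open CategoryTheory

namespace GroupHomologyZ
open groupHomology

/-! ### Functoriality in the coefficients and the long exact sequence -/

section Map
variable {k G : Type} [CommRing k] [Group G] {A B C : Rep.{0} k G}

/-- The map induced on homology by a morphism of representations. -/
noncomputable def hmap (φ : A ⟶ B) (n : ℕ) : groupHomology A n →ₗ[k] groupHomology B n :=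
  (groupHomology.map (MonoidHom.id G) φ n).hom

lemma hmap_id (n : ℕ) (x : groupHomology A n) : hmap (𝟙 A) n x = x := by
  simp [hmap]

lemma hmap_comp (φ : A ⟶ B) (ψ : B ⟶ C) (n : ℕ) (x : groupHomology A n) :
    hmap (φ ≫ ψ) n x = hmap ψ n (hmap φ n x) := by
  simp [hmap, map_id_comp]

lemma chainsMap_add (φ ψ : A ⟶ B) :
    chainsMap (MonoidHom.id G) (φ + ψ) =
      chainsMap (MonoidHom.id G) φ + chainsMap (MonoidHom.id G) ψ := by
  refine HomologicalComplex.hom_ext _ _ fun n => ModuleCat.hom_ext ?_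
  refine Finsupp.lhom_ext fun x a => ?_
  have := chainsMap_f_single (MonoidHom.id G) (φ + ψ) n x a
  have h1 := chainsMap_f_single (MonoidHom.id G) φ n x a
  have h2 := chainsMap_f_single (MonoidHom.id G) ψ n x a
  simp only [HomologicalComplex.add_f_apply, ModuleCat.hom_add, LinearMap.add_apply]
  erw [this, h1, h2, ← Finsupp.single_add]
  rfl

lemma hmap_add (φ ψ : A ⟶ B) (n : ℕ) : hmap (φ + ψ) n = hmap φ n + hmap ψ n := by
  simp only [hmap, groupHomology.map, chainsMap_add]
  rw [HomologicalComplex.homologyMap_add]; rfl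

lemma hmap_zero (n : ℕ) : hmap (0 : A ⟶ B) n = 0 := by
  have := hmap_add (0 : A ⟶ B) 0 n
  simpa using this

lemma hmap_nsmul (m : ℕ) (φ : A ⟶ B) (n : ℕ) : hmap (m • φ) n = m • hmap φ n := by
  induction m with
  | zero => simp [hmap_zero]
  | succ m ih => rw [succ_nsmul, succ_nsmul, hmap_add, ih]

lemma hmap_sum {ι : Type*} (s : Finset ι) (φ : ι → (A ⟶ B)) (n : ℕ) :
    hmap (∑ i ∈ s, φ i) n = ∑ i ∈ s, hmap (φ i) n := by
  classical
  induction s using Finset.induction_on with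
  | empty => simp [hmap_zero]
  | insert a s ha ih => rw [Finset.sum_insert ha, Finset.sum_insert ha, hmap_add, ih]

/-- Isomorphic coefficients have isomorphic homology. -/
noncomputable def hmapEquiv (e : A ≅ B) (n : ℕ) : groupHomology A n ≃ₗ[k] groupHomology B n :=
  LinearEquiv.ofLinearMap (hmap e.hom n) (hmap e.inv n)
    (by ext x; simp [← hmap_comp, hmap_id]) (by ext x; simp [← hmap_comp, hmap_id])

end Map

section LES
variable {k G : Type} [CommRing k] [Group G] {A B C : Rep.{0} k G}

lemma shortExact_of (φ : A ⟶ B) (ψ : B ⟶ C) (w : φ ≫ ψ = 0) (hφ : Function.Injective φ.hom)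
    (hψ : Function.Surjective ψ.hom) (h : ∀ b, ψ.hom b = 0 → ∃ a, φ.hom a = b) :
    (ShortComplex.mk φ ψ w).ShortExact := by
  have h1 : Mono φ := (Rep.mono_iff_injective φ).2 hφ
  have h2 : Epi ψ := (Rep.epi_iff_surjective ψ).2 hψ
  refine ShortComplex.ShortExact.mk ?_
  have : ((ShortComplex.mk φ ψ w).map (forget₂ (Rep k G) (ModuleCat k))).Exact := by
    rw [ShortComplex.moduleCat_exact_iff]
    intro b hb
    exact h b hb
  exact ((ShortComplex.mk φ ψ w).exact_map_iff_of_faithful _).1 this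

end LES
section LES
variable {k G : Type} [CommRing k] [Group G] {A B C : Rep.{0} k G}

lemma exists_longExact (φ : A ⟶ B) (ψ : B ⟶ C) (hφ : Function.Injective φ.hom)
    (hψ : Function.Surjective ψ.hom) (h : ∀ b, ψ.hom b = 0 ↔ ∃ a, φ.hom a = b) :
    ∃ δ : ∀ n, groupHomology C (n + 1) →ₗ[k] groupHomology A n,
      (∀ n, Function.Exact (hmap φ n) (hmap ψ n)) ∧
      (∀ n, Function.Exact (hmap ψ (n + 1)) (δ n)) ∧
      (∀ n, Function.Exact (δ n) (hmap φ n)) := by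
  have w : φ ≫ ψ = 0 := by
    ext a
    exact (h _).2 ⟨a, rfl⟩
  have hX := shortExact_of φ ψ w hφ hψ fun b hb => (h b).1 hb
  refine ⟨fun n => (groupHomology.δ hX (n + 1) n rfl).hom, fun n => ?_, fun n => ?_, fun n => ?_⟩
  · exact (ShortComplex.ShortExact.moduleCat_exact_iff_function_exact _).1 (mapShortComplex₂_exact hX n)
  · exact (ShortComplex.ShortExact.moduleCat_exact_iff_function_exact _).1 (mapShortComplex₃_exact hX (rfl : n + 1 = n + 1))
  · exact (ShortComplex.ShortExact.moduleCat_exact_iff_function_exact _).1 (mapShortComplex₁_exact hX (rfl : n + 1 = n + 1))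

/-- Homology in degree zero is the module of coinvariants. -/
noncomputable def zeroEquiv (A : Rep.{0} k G) :
    groupHomology A 0 ≃ₗ[k] A.ρ.Coinvariants := (H0Iso A).toLinearEquiv

lemma zeroEquiv_hmap (φ : A ⟶ B) (x : groupHomology A 0) :
    zeroEquiv B (hmap φ 0 x) = Representation.Coinvariants.map _ _ φ.hom (zeroEquiv A x) := by
  have := ConcreteCategory.congr_hom (map_id_comp_H0Iso_hom φ) x
  exact this

end LES

/-! ### Acyclic coefficient modules -/

section Acyclic
variable {k G : Type} [CommRing k] [Group G]

/-- The representation of `G` on all functions from `G` to a module, by right translation. -/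
noncomputable abbrev funRep (k G M : Type) [CommRing k] [Group G] [AddCommGroup M] [Module k M] :
    Rep.{0} k G := Rep.coind (⊥ : Subgroup G).subtype (Rep.trivial k (⊥ : Subgroup G) M)

lemma subsingleton_coind [Finite G] (S : Subgroup G) (A : Rep.{0} k S) (n : ℕ)
   [Subsingleton (groupHomology A n)] : Subsingleton (groupHomology (Rep.coind S.subtype A) n) := by
  classical
  exact ((hmapEquiv (Rep.indCoindIso A) n).symm.trans (indIso S A n).toLinearEquiv).toEquiv.subsingleton

lemma subsingleton_funRep [Finite G] (M : Type) [AddCommGroup M] [Module k M] (n : ℕ) :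
    Subsingleton (groupHomology (funRep k G M) (n + 1)) := by
  have := ModuleCat.subsingleton_of_isZero (isZero_groupHomology_succ_of_subsingleton (Rep.trivial k (⊥ : Subgroup G) M) n)
  exact subsingleton_coind _ _ _

/-- If `Θ = ∑ g, g⁻¹ θ g` for some linear map `θ`, then `Θ` kills homology in positive degrees. -/
lemma hmap_eq_zero_of_sum [Fintype G] {M : Rep.{0} k G} (Θ : M ⟶ M) (θ : M.V →ₗ[k] M.V)
    (h : ∀ m, Θ.hom m = ∑ g : G, M.ρ g⁻¹ (θ (M.ρ g m))) (n : ℕ) : hmap Θ (n + 1) = 0 := by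
  -- `Θ` factors through the acyclic module of functions on `G`: send m to g ↦ θ(g m), then f to the
  -- sum of g⁻¹ f(g).
  let i : M ⟶ funRep k G M.V := Rep.ofHom
    { toFun := fun m => ⟨fun g => θ (M.ρ g m), fun s g => by
        have : s = 1 := Subsingleton.elim _ _
        subst this
        simp⟩
      map_add' := fun x y => by ext g; simp
      map_smul' := fun r x => by ext g; simp
      isIntertwining' := fun g => by
        ext m x
        change θ (M.ρ x (M.ρ g m)) = θ (M.ρ (x * g) m)
        rw [map_mul]
        rfl }
  let j : funRep k G M.V ⟶ M := Rep.ofHom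
    { toFun := fun f => ∑ g : G, M.ρ g⁻¹ (f.1 g)
      map_add' := fun x y => by simp [Finset.sum_add_distrib]
      map_smul' := fun r x => by simp [Finset.smul_sum]
      isIntertwining' := fun g => by
        ext f
        simp only [LinearMap.comp_apply, LinearMap.coe_mk, AddHom.coe_mk, map_sum]
        refine Fintype.sum_equiv (Equiv.mulRight g) _ _ fun x => ?_
        simp [← Module.End.mul_apply, ← map_mul]
        rfl }
  have hij : Θ = i ≫ j := by
    ext m
    exact h m
  have := subsingleton_funRep (k := k) (G := G) M.V n
  ext x
  rw [hij, hmap_comp, Subsingleton.elim (hmap i (n + 1) x) 0]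
  simp

lemma subsingleton_of_sum [Fintype G] (M : Rep.{0} k G) (θ : M.V →ₗ[k] M.V)
    (h : ∀ m, m = ∑ g : G, M.ρ g⁻¹ (θ (M.ρ g m))) (n : ℕ) :
    Subsingleton (groupHomology M (n + 1)) := by
  have h0 := hmap_eq_zero_of_sum (𝟙 M) θ h n
  refine subsingleton_of_forall_eq 0 fun x => ?_
  rw [← hmap_id (n + 1) x, h0]
  rfl

end Acyclic

/-! ### Coset modules, Shapiro's lemma and multiplication by the index -/

section Trace
variable {k G : Type} [CommRing k] [Group G] [Finite G] (S : Subgroup G)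
  (A : Type) [AddCommGroup A] [Module k A]

/-- The representation of `G` on the `A`-valued functions on `S \ G`. -/
noncomputable abbrev cosetRep (k : Type) {G : Type} [CommRing k] [Group G] (S : Subgroup G)
    (A : Type) [AddCommGroup A] [Module k A] : Rep.{0} k G :=
  Rep.coind S.subtype (Rep.trivial k S A)

variable {A} in
/-- The function on `S \ G` defined by an element of `cosetRep`. -/
def cosetRep.onQuotient {S : Subgroup G} (f : cosetRep k S A) :
    Quotient (QuotientGroup.rightRel S) → A :=
  Quotient.lift f.1 fun a b hab => by
    replace hab := QuotientGroup.rightRel_apply.1 hab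
    have := f.2 ⟨b * a⁻¹, hab⟩ a
    simpa using this.symm

/-- Constant functions on `S \ G`. -/
noncomputable def constMap : Rep.trivial k G A ⟶ cosetRep k S A := Rep.ofHom
  { toFun := fun a => ⟨fun _ => a, fun _ _ => by simp⟩
    map_add' := fun x y => by ext; simp
    map_smul' := fun r x => by ext; simp
    isIntertwining' := fun g => by
      ext m x
      simp
      rfl }

open Classical in
/-- Summation of a function over `S \ G`. -/
noncomputable def sumMap : cosetRep k S A ⟶ Rep.trivial k G A := Rep.ofHom
  { toFun := fun f => ∑ᶠ c, cosetRep.onQuotient f c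
    map_add' := fun x y => by
      rw [← finsum_add_distrib (Set.toFinite _) (Set.toFinite _)]
      refine finsum_congr fun c => ?_
      induction c using Quotient.inductionOn with | h g => rfl
    map_smul' := fun r x => by
      simp only [RingHom.id_apply]
      rw [smul_finsum' r (Set.toFinite _)]
      refine finsum_congr fun c => ?_
      induction c using Quotient.inductionOn with | h g => rfl
    isIntertwining' := fun g => by
      ext f
      have hmap : ∀ x : G, ∀ a b : G, QuotientGroup.rightRel S a b →
          QuotientGroup.rightRel S (a * x) (b * x) := fun x a b hab => by
        rw [QuotientGroup.rightRel_apply] at hab ⊢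
        simpa [mul_assoc] using hab
      let e : Quotient (QuotientGroup.rightRel S) ≃ Quotient (QuotientGroup.rightRel S) :=
        { toFun := Quotient.map (· * g) (hmap g)
          invFun := Quotient.map (· * g⁻¹) (hmap g⁻¹)
          left_inv := fun c => by
            induction c using Quotient.inductionOn with | h x => simp
          right_inv := fun c => by
            induction c using Quotient.inductionOn with | h x => simp }
      refine finsum_eq_of_bijective e e.bijective fun c => ?_
      induction c using Quotient.inductionOn with | h x => rfl }

lemma constMap_sumMap : constMap S A ≫ sumMap S A = (S.index • 𝟙 (Rep.trivial k G A)) := by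
  classical
  ext a
  have := Fintype.ofFinite (Quotient (QuotientGroup.rightRel S))
  change ∑ᶠ c, cosetRep.onQuotient ((constMap (k := k) S A).hom a) c = S.index • a
  have h1 : ∀ c, cosetRep.onQuotient ((constMap (k := k) S A).hom a) c = a := fun c => by
    induction c using Quotient.inductionOn with | h x => rfl
  simp only [h1]
  rw [finsum_eq_sum_of_fintype, Finset.sum_const, Finset.card_univ, Subgroup.index,
    ← Nat.card_eq_fintype_card, Nat.card_congr (QuotientGroup.quotientRightRelEquivQuotientLeftRel S)]

/-- Shapiro's lemma for coinduced trivial modules. -/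
noncomputable def shapiro (n : ℕ) :
    groupHomology (cosetRep k S A) n ≃ₗ[k] groupHomology (Rep.trivial k S A) n := by
  classical
  exact (hmapEquiv (Rep.indCoindIso (Rep.trivial k S A)) n).symm.trans
    (indIso S (Rep.trivial k S A) n).toLinearEquiv

/-- If `m` kills the homology of a subgroup, then `m` times the index kills that of the group. -/
lemma index_mul_nsmul_eq_zero (m n : ℕ) (h : ∀ y : groupHomology (Rep.trivial k S A) n, m • y = 0)
    (x : groupHomology (Rep.trivial k G A) n) : (S.index * m) • x = 0 := by
  -- Multiplication by the index factors through the coset module, whose homology is that of `S`.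
  have h1 : S.index • x = hmap (sumMap S A) n (hmap (constMap S A) n x) := by
    rw [← hmap_comp, constMap_sumMap, hmap_nsmul]
    simp [hmap_id]
  rw [mul_comm, mul_smul, h1, ← map_nsmul]
  have : m • hmap (constMap S A) n x = 0 := by
    apply (shapiro S A n).injective
    rw [map_nsmul, h, map_zero]
  rw [this, map_zero]

end Trace

/-! ### Transfer to a direct factor, by dimension shifting -/

section Cores
variable {k G W : Type} [CommRing k] [Group G] [Group W]

lemma chainsMap_res_comp (f : W →* G) {A B : Rep.{0} k G} (φ : A ⟶ B) :
    chainsMap f (𝟙 (Rep.res f A)) ≫ chainsMap (MonoidHom.id G) φ =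
      chainsMap (MonoidHom.id W) ((Rep.resFunctor f).map φ) ≫ chainsMap f (𝟙 (Rep.res f B)) := by
  rw [← chainsMap_comp, ← chainsMap_comp]
  exact chainsMap_congr rfl rfl

lemma map_δ (f : W →* G) {X : ShortComplex (Rep.{0} k G)} (hX : X.ShortExact)
    (hX' : (X.map (Rep.resFunctor f)).ShortExact) (n : ℕ) :
    δ hX' (n + 1) n rfl ≫ groupHomology.map f (𝟙 _) n =
      groupHomology.map f (𝟙 _) (n + 1) ≫ δ hX (n + 1) n rfl := by
  let φ : (X.map (Rep.resFunctor f)).map (chainsFunctor k W) ⟶ X.map (chainsFunctor k G) :=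
    { τ₁ := chainsMap f (𝟙 _)
      τ₂ := chainsMap f (𝟙 _)
      τ₃ := chainsMap f (𝟙 _)
      comm₁₂ := chainsMap_res_comp f X.f
      comm₂₃ := chainsMap_res_comp f X.g }
  exact HomologicalComplex.HomologySequence.δ_naturality φ (map_chainsFunctor_shortExact hX')
    (map_chainsFunctor_shortExact hX) (n + 1) n rfl

/-- The natural transformation from homology of `W` to homology of `G` along `f : W →* G`. -/
noncomputable def cores (f : W →* G) (M : Rep.{0} k G) (n : ℕ) :
    groupHomology (Rep.res f M) n →ₗ[k] groupHomology M n :=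
  (groupHomology.map f (𝟙 (Rep.res f M)) n).hom

lemma zeroEquiv_cores (f : W →* G) (M : Rep.{0} k G) (m : M.V) :
    zeroEquiv M (cores f M 0 ((zeroEquiv (Rep.res f M)).symm
      (Representation.Coinvariants.mk (Rep.res f M).ρ m))) = Representation.Coinvariants.mk M.ρ m := by
  have h1 : (zeroEquiv (Rep.res f M)).symm (Representation.Coinvariants.mk (Rep.res f M).ρ m) =
      H0π (Rep.res f M) m := by
    rw [LinearEquiv.symm_apply_eq]
    exact (H0π_comp_H0Iso_hom_apply _ _).symm
  have h2 := ConcreteCategory.congr_hom (H0π_comp_map f (𝟙 (Rep.res f M))) m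
  rw [h1]
  exact (congrArg (zeroEquiv M) h2).trans (H0π_comp_H0Iso_hom_apply M m)

end Cores

section Dimension
variable {k G : Type} [CommRing k] [Group G]

/-- The canonical surjection onto `M` from a representation with vanishing homology. -/
noncomputable def evalSum [Fintype G] (M : Rep.{0} k G) : funRep k G M.V ⟶ M := Rep.ofHom
    { toFun := fun f => ∑ g : G, M.ρ g⁻¹ (f.1 g)
      map_add' := fun x y => by simp [Finset.sum_add_distrib]
      map_smul' := fun r x => by simp [Finset.smul_sum]
      isIntertwining' := fun g => by
        ext f
        simp only [LinearMap.comp_apply, LinearMap.coe_mk, AddHom.coe_mk, map_sum]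
        refine Fintype.sum_equiv (Equiv.mulRight g) _ _ fun x => ?_
        simp [← Module.End.mul_apply, ← map_mul]
        rfl }

lemma evalSum_surjective [Fintype G] (M : Rep.{0} k G) : Function.Surjective (evalSum M).hom := by
  classical
  intro m
  refine ⟨⟨Pi.single 1 m, fun s h => ?_⟩, ?_⟩
  · have : s = 1 := Subsingleton.elim _ _
    subst this
    simp
  · change ∑ g : G, M.ρ g⁻¹ ((Pi.single 1 m : G → M.V) g) = m
    rw [Finset.sum_eq_single 1]
    · simp
    · intro b _ hb
      simp [hb]
    · simp

/-- The kernel of a morphism of representations. -/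
noncomputable abbrev kerRep {A B : Rep.{0} k G} (φ : A ⟶ B) : Rep.{0} k G :=
  Rep.subrepresentation A (LinearMap.ker φ.hom.toLinearMap) fun g x hx => by
    have h1 : φ.hom x = 0 := hx
    change φ.hom (A.ρ g x) = 0
    rw [Rep.hom_comm_apply, h1, map_zero]

/-- The inclusion of the kernel. -/
noncomputable abbrev kerIncl {A B : Rep.{0} k G} (φ : A ⟶ B) : kerRep φ ⟶ A :=
  Rep.subtype A _ _

lemma kerIncl_comp {A B : Rep.{0} k G} (φ : A ⟶ B) : kerIncl φ ≫ φ = 0 := by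
  ext x
  exact x.2

lemma kerIncl_shortExact {A B : Rep.{0} k G} (φ : A ⟶ B) (h : Function.Surjective φ.hom) :
    (ShortComplex.mk (kerIncl φ) φ (kerIncl_comp φ)).ShortExact :=
  shortExact_of _ _ _ Subtype.val_injective h fun b hb => ⟨⟨b, hb⟩, rfl⟩

variable {W C : Type} [Group W] [Group C]

/-- A function as an element of `funRep`. -/
def funRep.ofFun {M : Type} [AddCommGroup M] [Module k M] (f : G → M) : funRep k G M :=
  ⟨f, fun s h => by
    have : s = 1 := Subsingleton.elim _ _
    subst this
    simp⟩

/-- The operator `θ` truncates a function to the slice {1} × C. The translates of this slice under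
`W` partition W × C, so the conjugates of `θ` add up to the identity. -/
lemma subsingleton_res_inl_funRep [Fintype W] (M : Type) [AddCommGroup M] [Module k M] (n : ℕ) :
    Subsingleton (groupHomology (Rep.res (MonoidHom.inl W C) (funRep k (W × C) M)) (n + 1)) := by
  classical
  let θ : funRep k (W × C) M →ₗ[k] funRep k (W × C) M :=
    { toFun := fun f => funRep.ofFun fun h => if h.1 = 1 then f.1 h else 0
      map_add' := fun x y => by
        ext h
        change (if h.1 = 1 then x.1 h + y.1 h else 0) =
          (if h.1 = 1 then x.1 h else 0) + (if h.1 = 1 then y.1 h else 0)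
        split_ifs <;> simp
      map_smul' := fun r x => by
        ext h
        change (if h.1 = 1 then r • x.1 h else 0) = r • (if h.1 = 1 then x.1 h else 0)
        split_ifs <;> simp }
  refine subsingleton_of_sum (G := W)
    (Rep.res (MonoidHom.inl W C) (funRep k (W × C) M)) θ (fun f => ?_) n
  apply Subtype.ext
  funext h
  have key : ∀ w : W, (((Rep.res (MonoidHom.inl W C) (funRep k (W × C) M)).ρ w⁻¹ (θ
      ((Rep.res (MonoidHom.inl W C) (funRep k (W × C) M)).ρ w f))).1 h) =
      if h.1 = w then f.1 h else 0 := fun w => by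
    change (if (h * (w⁻¹, 1)).1 = 1 then f.1 (h * (w⁻¹, 1) * (w, 1)) else 0) = _
    simp [mul_inv_eq_one, mul_assoc, ← Prod.one_eq_mk]
  have hsum : (∑ w : W, (Rep.res (MonoidHom.inl W C) (funRep k (W × C) M)).ρ w⁻¹ (θ
      ((Rep.res (MonoidHom.inl W C) (funRep k (W × C) M)).ρ w f))).1 h =
      ∑ w : W, (((Rep.res (MonoidHom.inl W C) (funRep k (W × C) M)).ρ w⁻¹ (θ
      ((Rep.res (MonoidHom.inl W C) (funRep k (W × C) M)).ρ w f))).1 h) := by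
    erw [AddSubmonoidClass.coe_finsetSum, Finset.sum_apply]
  rw [hsum, Finset.sum_congr rfl fun w _ => key w]
  simp

/-- The transfer to the first factor of a product, on coinvariants. -/
noncomputable def trCoinvariants [Fintype C] (M : Rep.{0} k (W × C)) :
    M.ρ.Coinvariants →ₗ[k] (Rep.res (MonoidHom.inl W C) M).ρ.Coinvariants :=
  Representation.Coinvariants.lift _
    (Representation.Coinvariants.mk (Rep.res (MonoidHom.inl W C) M).ρ ∘ₗ
      (∑ c : C, M.ρ (1, c) : M.V →ₗ[k] M.V)) fun g => by
    ext x
    have h1 : (∑ c : C, M.ρ (1, c) : M.V →ₗ[k] M.V) (M.ρ g x) =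
        M.ρ (g.1, 1) ((∑ c : C, M.ρ (1, c) : M.V →ₗ[k] M.V) x) := by
      simp only [LinearMap.sum_apply, map_sum, ← Module.End.mul_apply, ← map_mul]
      refine Fintype.sum_equiv (Equiv.mulRight g.2) _ _ fun c => ?_
      simp [Prod.mul_def]
    simp only [LinearMap.comp_apply, h1]
    exact Representation.Coinvariants.mk_self_apply (Rep.res (MonoidHom.inl W C) M).ρ g.1 _

lemma cores_tr [Fintype C] (M : Rep.{0} k (W × C)) (x : groupHomology M 0) :
    cores (MonoidHom.inl W C) M 0 ((zeroEquiv _).symm (trCoinvariants M (zeroEquiv M x))) =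
      Fintype.card C • x := by
  apply (zeroEquiv M).injective
  rw [map_nsmul]
  induction zeroEquiv M x using Representation.Coinvariants.induction_on with | _ m
  change zeroEquiv M (cores _ M 0 ((zeroEquiv _).symm (Representation.Coinvariants.mk _
    ((∑ c : C, M.ρ (1, c) : M.V →ₗ[k] M.V) m)))) = _
  rw [zeroEquiv_cores, LinearMap.sum_apply, map_sum]
  simp

lemma trCoinvariants_naturality [Fintype C] {M N : Rep.{0} k (W × C)} (φ : M ⟶ N)
    (x : M.ρ.Coinvariants) :
    trCoinvariants N (Representation.Coinvariants.map _ _ φ.hom x) =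
      Representation.Coinvariants.map _ _ ((Rep.resFunctor (MonoidHom.inl W C)).map φ).hom
        (trCoinvariants M x) := by
  induction x using Representation.Coinvariants.induction_on with | _ m
  change Representation.Coinvariants.mk (Rep.res (MonoidHom.inl W C) N).ρ
    ((∑ c : C, N.ρ (1, c) : N.V →ₗ[k] N.V) (φ.hom m)) =
    Representation.Coinvariants.mk (Rep.res (MonoidHom.inl W C) N).ρ
    (φ.hom ((∑ c : C, M.ρ (1, c) : M.V →ₗ[k] M.V) m))
  simp [LinearMap.sum_apply, map_sum, Rep.hom_comm_apply]

/-- This replaces the identity "corestriction after transfer is the index". In degree zero the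
transfer is the explicit norm over `C`; higher degrees reduce to it through the connecting maps of
the surjection `evalSum` from an acyclic module. -/
theorem exists_cores_eq_card_nsmul [Fintype W] [Fintype C] (n : ℕ) : ∀ (M : Rep.{0} k (W × C))
    (x : groupHomology M n), ∃ y, cores (MonoidHom.inl W C) M n y = Fintype.card C • x := by
  induction n with
  | zero => exact fun M x => ⟨_, cores_tr M x⟩
  | succ n ih =>
    intro M x
    have hX := kerIncl_shortExact (evalSum M) (evalSum_surjective M)
    have hX' := hX.map_of_exact (Rep.resFunctor (MonoidHom.inl W C))
    have hG := subsingleton_funRep (k := k) (G := W × C) M.V n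
    have hinj : Function.Injective (groupHomology.δ hX (n + 1) n rfl) := by
      have := mono_δ_of_isZero hX n (ModuleCat.isZero_of_subsingleton _)
      exact (ModuleCat.mono_iff_injective _).1 this
    obtain ⟨y, hy, z, hz⟩ : ∃ y, cores (MonoidHom.inl W C) _ n y =
        Fintype.card C • groupHomology.δ hX (n + 1) n rfl x ∧
        ∃ z, groupHomology.δ hX' (n + 1) n rfl z = y := by
      have hex := (ShortComplex.ShortExact.moduleCat_exact_iff_function_exact _).1
        (mapShortComplex₁_exact hX' (rfl : n + 1 = n + 1))
      cases n with
      | zero =>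
        -- Acyclicity says nothing about degree zero. The class lifts along the connecting map over
        -- `W` because it is the transfer of a boundary and the transfer on coinvariants is natural.
        refine ⟨_, cores_tr _ _, (hex _).1 ?_⟩
        have h0 : hmap (kerIncl (evalSum M)) 0 (groupHomology.δ hX (0 + 1) 0 rfl x) = 0 :=
          ((ShortComplex.ShortExact.moduleCat_exact_iff_function_exact _).1
            (mapShortComplex₁_exact hX (rfl : 0 + 1 = 0 + 1))).apply_apply_eq_zero x
        change hmap ((Rep.resFunctor (MonoidHom.inl W C)).map (kerIncl (evalSum M))) 0 _ = 0
        apply (zeroEquiv _).injective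
        rw [zeroEquiv_hmap, LinearEquiv.apply_symm_apply, ← trCoinvariants_naturality,
          ← zeroEquiv_hmap, h0]
        simp
      | succ n =>
        obtain ⟨y, hy⟩ := ih _ (groupHomology.δ hX (n + 1 + 1) (n + 1) rfl x)
        refine ⟨y, hy, (hex y).1 ?_⟩
        have := subsingleton_res_inl_funRep (k := k) (W := W) (C := C) M.V n
        exact this.elim _ _
    refine ⟨z, hinj ?_⟩
    have hδ := ConcreteCategory.congr_hom (map_δ (MonoidHom.inl W C) hX hX' n) z
    refine hδ.symm.trans ?_
    rw [map_nsmul, ← hy, ← hz]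
    rfl

end Dimension

/-! ### Exponent of the homology of elementary abelian groups -/

section Exponent

/-- The identity of `ℤ`, from a trivial representation to a restricted one. -/
noncomputable def trivialRes {W G : Type} [Group W] [Group G] (f : W →* G) :
    Rep.trivial ℤ W ℤ ⟶ Rep.res f (Rep.trivial ℤ G ℤ) :=
  Rep.ofHom ⟨LinearMap.id, fun _ => rfl⟩

/-- The map on integral homology induced by a group homomorphism. -/
noncomputable def integralMap {W G : Type} [Group W] [Group G] (f : W →* G) (n : ℕ) :
    integralHomology W n ⟶ integralHomology G n :=
  groupHomology.map f (trivialRes f) n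

lemma integralMap_comp_eq_id {W G : Type} [Group W] [Group G] (f : W →* G) (g : G →* W)
    (h : g.comp f = MonoidHom.id W) (n : ℕ) : integralMap f n ≫ integralMap g n = 𝟙 _ := by
  unfold integralMap
  rw [← groupHomology.map_comp, ← groupHomology.map_id]
  exact groupHomology.map_congr h rfl n

/-- If `p` kills the integral homology of `W` in degree `n`, it kills that of `W × C` for `C` of
order `p`. -/
lemma nsmul_prod_eq_zero {W C : Type} [Group W] [Group C] [Fintype W] [Fintype C] (n : ℕ)
    (h : ∀ y : integralHomology W n, Fintype.card C • y = 0) (x : integralHomology (W × C) n) :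
    Fintype.card C • x = 0 := by
  obtain ⟨(y : integralHomology W n), hy⟩ :=
    exists_cores_eq_card_nsmul (k := ℤ) n (Rep.trivial ℤ (W × C) ℤ) x
  replace hy : (integralMap (MonoidHom.inl W C) n).hom y = Fintype.card C • x := hy
  -- Projecting back to `W` recovers y, but also gives |C| times a class of `W`, which is zero.
  have h1 : (integralMap (MonoidHom.fst W C) n).hom ((integralMap (MonoidHom.inl W C) n).hom y) = y :=
    ConcreteCategory.congr_hom (integralMap_comp_eq_id _ _ MonoidHom.fst_comp_inl n) y
  have h2 : (integralMap (MonoidHom.fst W C) n).hom ((integralMap (MonoidHom.inl W C) n).hom y) = 0 := by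
    rw [hy, map_nsmul, h]
  rw [← hy, show y = 0 from h1.symm.trans h2]
  exact map_zero _

lemma nsmul_eq_zero_of_mulEquiv {V W : Type} [Group V] [Group W] (e : V ≃* W) (m n : ℕ)
    (h : ∀ y : integralHomology W n, m • y = 0) (x : integralHomology V n) : m • x = 0 := by
  have i : integralHomology V n ≃ₗ[ℤ] integralHomology W n :=
    (groupHomology.mapIso (A := Rep.trivial ℤ V ℤ) (B := Rep.trivial ℤ W ℤ) e
      (LinearEquiv.refl ℤ ℤ) (fun g => rfl) n).toLinearEquiv
  apply i.injective
  rw [map_nsmul, h, map_zero]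

/-- Integral homology of an elementary abelian `p`-group has exponent `p` in positive degrees. -/
lemma nsmul_pi_zmod_eq_zero (p : ℕ) [NeZero p] (n f : ℕ)
    (x : integralHomology (Multiplicative (Fin f → ZMod p)) (n + 1)) : p • x = 0 := by
  induction f with
  | zero =>
    have := ModuleCat.subsingleton_of_isZero (isZero_groupHomology_succ_of_subsingleton
      (Rep.trivial ℤ (Multiplicative (Fin 0 → ZMod p)) ℤ) n)
    exact this.elim _ _
  | succ f ih =>
    have e : Multiplicative (Fin (f + 1) → ZMod p) ≃*
        Multiplicative (Fin f → ZMod p) × Multiplicative (ZMod p) :=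
      (AddEquiv.toMultiplicative ((Fin.consLinearEquiv ℤ fun _ : Fin (f + 1) => ZMod p).symm.toAddEquiv.trans
        AddEquiv.prodComm)).trans (MulEquiv.prodMultiplicative _ _)
    refine nsmul_eq_zero_of_mulEquiv e p (n + 1) (fun y => ?_) x
    have hc : Fintype.card (Multiplicative (ZMod p)) = p := by
      rw [Fintype.card_multiplicative, ZMod.card]
    have := nsmul_prod_eq_zero (W := Multiplicative (Fin f → ZMod p))
      (C := Multiplicative (ZMod p)) (n + 1) (by simpa [hc] using ih) y
    rwa [hc] at this

end Exponent

/-! ### SL₂, its Borel subgroup and the Steinberg splitting -/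

section SL2
variable {F : Type} [Field F]

/-- The special linear group of degree two. -/
abbrev SL2 (F : Type) [Field F] := Matrix.SpecialLinearGroup (Fin 2) F

/-- A matrix in `SL₂` given by its entries. -/
def SL2.mk (a b c d : F) (h : a * d - b * c = 1) : SL2 F :=
  ⟨!![a, b; c, d], by rw [Matrix.det_fin_two_of, h]⟩

lemma SL2.det_eq (g : SL2 F) : g 0 0 * g 1 1 - g 0 1 * g 1 0 = 1 := by
  have := g.2
  rwa [Matrix.det_fin_two] at this

lemma SL2.ext_iff' {g h : SL2 F} :
    g = h ↔ g 0 0 = h 0 0 ∧ g 0 1 = h 0 1 ∧ g 1 0 = h 1 0 ∧ g 1 1 = h 1 1 := by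
  rw [Matrix.SpecialLinearGroup.ext_iff]
  simp [Fin.forall_fin_two, and_assoc]

lemma SL2.mul_entry (g h : SL2 F) (i j : Fin 2) :
    (g * h) i j = g i 0 * h 0 j + g i 1 * h 1 j := by
  simp [Matrix.mul_apply, Fin.sum_univ_two]

lemma SL2.inv_entries (g : SL2 F) :
    (g⁻¹) 0 0 = g 1 1 ∧ (g⁻¹) 0 1 = - g 0 1 ∧ (g⁻¹) 1 0 = - g 1 0 ∧ (g⁻¹) 1 1 = g 0 0 := by
  rw [Matrix.SpecialLinearGroup.SL2_inv_expl]
  simp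

/-- The upper triangular matrices. -/
def borel (F : Type) [Field F] : Subgroup (SL2 F) where
  carrier := {g | g 1 0 = 0}
  mul_mem' {g h} (hg : g 1 0 = 0) (hh : h 1 0 = 0) := by
    change (g * h) 1 0 = 0
    rw [SL2.mul_entry, hg, hh]
    ring
  one_mem' := by simp
  inv_mem' {g} (hg : g 1 0 = 0) := by
    change (g⁻¹) 1 0 = 0
    rw [(SL2.inv_entries g).2.2.1, hg, neg_zero]

lemma mem_borel {g : SL2 F} : g ∈ borel F ↔ g 1 0 = 0 := Iff.rfl

/-- The upper triangular unipotent matrices. -/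
def unipotent (F : Type) [Field F] : Subgroup (SL2 F) where
  carrier := {g | g 1 0 = 0 ∧ g 1 1 = 1}
  mul_mem' {g h} hg hh := by
    change (g * h) 1 0 = 0 ∧ (g * h) 1 1 = 1
    simp [SL2.mul_entry, hg.1, hg.2, hh.1, hh.2]
  one_mem' := by simp
  inv_mem' {g} hg := by
    have h1 := SL2.det_eq g
    rw [hg.1, hg.2] at h1
    change (g⁻¹) 1 0 = 0 ∧ (g⁻¹) 1 1 = 1
    rw [(SL2.inv_entries g).2.2.1, (SL2.inv_entries g).2.2.2, hg.1]
    simpa using h1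

lemma mem_unipotent {g : SL2 F} : g ∈ unipotent F ↔ g 1 0 = 0 ∧ g 1 1 = 1 := Iff.rfl

/-- The elementary unipotent matrix with upper right entry `b`. -/
def upper (b : F) : SL2 F := SL2.mk 1 b 0 1 (by ring)

/-- The diagonal matrix with entries `t`, `t⁻¹`. -/
def diag (t : Fˣ) : SL2 F := SL2.mk t 0 0 (t⁻¹ : Fˣ) (by simp)

/-- The Weyl element. -/
def weyl : SL2 F := SL2.mk 0 1 (-1) 0 (by ring)

@[simp] lemma SL2.mk_entries (a b c d : F) (h : a * d - b * c = 1) :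
    SL2.mk a b c d h 0 0 = a ∧ SL2.mk a b c d h 0 1 = b ∧ SL2.mk a b c d h 1 0 = c ∧
      SL2.mk a b c d h 1 1 = d := by
  simp [SL2.mk]

/-- The unipotent radical is isomorphic to the additive group of the field. -/
def unipotentEquiv (F : Type) [Field F] : unipotent F ≃* Multiplicative F where
  toFun g := Multiplicative.ofAdd (g.1 0 1)
  invFun b := ⟨upper b.toAdd, by simp [mem_unipotent, upper]⟩
  left_inv g := by
    have h1 := SL2.det_eq g.1
    have h2 := mem_unipotent.1 g.2
    rw [h2.1, h2.2] at h1
    apply Subtype.ext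
    rw [SL2.ext_iff']
    simp [upper, h2.1, h2.2]
    simpa using h1.symm
  right_inv b := by simp [upper]
  map_mul' g h := by
    have h1 := SL2.det_eq g.1
    have h2 := mem_unipotent.1 g.2
    have h3 := mem_unipotent.1 h.2
    rw [h2.1, h2.2] at h1
    rw [← ofAdd_add, Subgroup.coe_mul, SL2.mul_entry, h3.2, show g.1 0 0 = 1 by simpa using h1]
    ring_nf

/-- A right coset of the unipotent subgroup is determined by its bottom row, an arbitrary nonzero
vector. -/
lemma index_unipotent [Finite F] : (unipotent F).index + 1 = Nat.card F ^ 2 := by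
  classical
  have h1 : ∀ g h : SL2 F, QuotientGroup.rightRel (unipotent F) g h ↔
      g 1 0 = h 1 0 ∧ g 1 1 = h 1 1 := fun g h => by
    rw [QuotientGroup.rightRel_apply, mem_unipotent]
    have hd := SL2.det_eq g
    have hd' := SL2.det_eq h
    obtain ⟨i1, i2, i3, i4⟩ := SL2.inv_entries g
    simp only [SL2.mul_entry, i1, i2, i3, i4]
    constructor
    · rintro ⟨h1, h2⟩
      constructor
      · linear_combination (h 1 0) * hd - g 0 0 * h1 - g 1 0 * h2
      · linear_combination (h 1 1) * hd - g 0 1 * h1 - g 1 1 * h2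
    · rintro ⟨h1, h2⟩
      rw [← h1, ← h2]
      constructor
      · ring
      · linear_combination hd
  let φ : Quotient (QuotientGroup.rightRel (unipotent F)) → {v : F × F // v ≠ 0} :=
    Quotient.lift (fun g => ⟨(g 1 0, g 1 1), fun h0 => by
      have hd := SL2.det_eq g
      simp only [Prod.mk_eq_zero] at h0
      rw [h0.1, h0.2] at hd
      simp at hd⟩) fun g h hgh => by
        have := (h1 g h).1 hgh
        simp [this.1, this.2]
  have hφ : Function.Bijective φ := by
    constructor
    · intro x y
      induction x using Quotient.inductionOn with | h g
      induction y using Quotient.inductionOn with | h h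
      intro hxy
      have : (g 1 0, g 1 1) = (h 1 0, h 1 1) := congrArg Subtype.val hxy
      exact Quotient.sound ((h1 g h).2 (by simpa using this))
    · rintro ⟨⟨c, d⟩, hv⟩
      by_cases hc : c = 0
      · have hd : d ≠ 0 := fun hd => hv (by simp [hc, hd])
        refine ⟨⟦SL2.mk d⁻¹ 0 c d (by field_simp; simp)⟧, ?_⟩
        apply Subtype.ext
        change (_, _) = _
        simp
      · refine ⟨⟦SL2.mk 0 (-c⁻¹) c d (by field_simp; simp)⟧, ?_⟩
        apply Subtype.ext
        change (_, _) = _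
        simp
  have h2 := Nat.card_congr (Equiv.ofBijective φ hφ)
  rw [Nat.card_congr (QuotientGroup.quotientRightRelEquivQuotientLeftRel _)] at h2
  have h3 : (unipotent F).index = Nat.card {v : F × F // v ≠ 0} := h2
  have := Fintype.ofFinite F
  rw [h3, Nat.card_eq_fintype_card, Fintype.card_subtype_compl, Fintype.card_subtype_eq,
    Nat.card_eq_fintype_card, Fintype.card_prod, pow_two]
  have : 0 < Fintype.card F := Fintype.card_pos
  have : 0 < Fintype.card F * Fintype.card F := by positivity
  omega

/-- The Bruhat decomposition of the right cosets of the Borel subgroup. -/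
lemma bruhat_bijective (h : SL2 F) : Function.Bijective (fun o : Option F =>
    (o.elim ⟦h⟧ fun b => ⟦weyl * upper b * h⟧ : Quotient (QuotientGroup.rightRel (borel F)))) := by
  have key : ∀ g h : SL2 F, (⟦g⟧ : Quotient (QuotientGroup.rightRel (borel F))) = ⟦h⟧ ↔
      h 1 0 * g 1 1 = h 1 1 * g 1 0 := fun g h => by
    rw [Quotient.eq, QuotientGroup.rightRel_apply, mem_borel]
    obtain ⟨i1, i2, i3, i4⟩ := SL2.inv_entries g
    simp only [SL2.mul_entry, i1, i3]
    rw [← sub_eq_zero (a := h 1 0 * g 1 1)]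
    ring_nf
  have hw : ∀ b, (weyl * upper b * h : SL2 F) 1 0 = - h 0 0 - b * h 1 0 ∧
      (weyl * upper b * h : SL2 F) 1 1 = - h 0 1 - b * h 1 1 := fun b => by
    simp only [SL2.mul_entry]
    simp [weyl, upper]
    constructor <;> ring
  have hd := SL2.det_eq h
  constructor
  · rintro (_ | b) (_ | c) hbc
    · rfl
    · simp only [Option.elim] at hbc
      rw [key, (hw _).1, (hw _).2] at hbc
      exact absurd (show (1 : F) = 0 by linear_combination (-1 : F) * hd - hbc) one_ne_zero
    · simp only [Option.elim] at hbc
      rw [key, (hw _).1, (hw _).2] at hbc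
      exact absurd (show (1 : F) = 0 by linear_combination (-1 : F) * hd + hbc) one_ne_zero
    · simp only [Option.elim] at hbc
      rw [key, (hw _).1, (hw _).2, (hw _).1, (hw _).2] at hbc
      congr 1
      linear_combination  (c - b) * hd + hbc
  · intro x
    induction x using Quotient.inductionOn with | h g
    by_cases hc : g 1 0 * h 1 1 = g 1 1 * h 1 0
    · exact ⟨none, (key _ _).2 hc⟩
    · have hc' : g 1 0 * h 1 1 - g 1 1 * h 1 0 ≠ 0 := sub_ne_zero.2 hc
      refine ⟨some ((g 1 1 * h 0 0 - g 1 0 * h 0 1) / (g 1 0 * h 1 1 - g 1 1 * h 1 0)), (key _ _).2 ?_⟩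
      rw [(hw _).1, (hw _).2]
      field_simp
      ring

variable [Finite F]

/-- Summation over `borel F \\ SL₂` via the Bruhat decomposition. -/
lemma sumMap_borel (f : cosetRep ℤ (borel F) F) (h : SL2 F) [Fintype F] :
    (sumMap (borel F) F).hom f = f.1 h + ∑ b : F, f.1 (weyl * upper b * h) := by
  change ∑ᶠ c, cosetRep.onQuotient f c = _
  rw [← finsum_eq_of_bijective _ (bruhat_bijective h) (fun o => rfl), finsum_eq_sum_of_fintype,
    Fintype.sum_option]
  rfl

lemma index_borel : (borel F).index = Nat.card F + 1 := by
  have := Nat.card_congr (Equiv.ofBijective _ (bruhat_bijective (1 : SL2 F)))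
  rw [Nat.card_congr (QuotientGroup.quotientRightRelEquivQuotientLeftRel _)] at this
  rw [Finite.card_option] at this
  exact this.symm

/-- The index q + 1 of the Borel subgroup is 1 in `F`, so the constants split off. -/
lemma constMap_sumMap_borel : constMap (k := ℤ) (borel F) F ≫ sumMap (borel F) F = 𝟙 _ := by
  rw [constMap_sumMap, index_borel]
  ext a
  change (Nat.card F + 1) • (a : F) = a
  have := Fintype.ofFinite F
  rw [nsmul_eq_mul, Nat.card_eq_fintype_card]
  simp

/-- The complementary projection is the one onto the Steinberg summand. By the Bruhat decomposition
based at h it sends f to h ↦ −∑ f(w u_b h). This is the norm of the operator `θ` taking f to f(w)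
times the indicator of the Borel subgroup, so it vanishes on homology. -/
lemma hmap_id_sub_eq_zero (n : ℕ) :
    hmap (𝟙 _ - sumMap (borel F) F ≫ constMap (k := ℤ) (borel F) F) (n + 1) = 0 := by
  classical
  have := Fintype.ofFinite F
  let θ : cosetRep ℤ (borel F) F →ₗ[ℤ] cosetRep ℤ (borel F) F :=
    { toFun := fun f => ⟨fun g => if g 1 0 = 0 then f.1 weyl else 0, fun s g => by
        have hs := mem_borel.1 s.2
        have hd := SL2.det_eq s.1
        have h1 : s.1 1 1 ≠ 0 := fun h0 => by
          rw [hs, h0] at hd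
          simp at hd
        have h2 : (s.1 * g) 1 0 = 0 ↔ g 1 0 = 0 := by
          rw [SL2.mul_entry, hs]
          simp [h1]
        simp only [Subgroup.subtype_apply, h2]
        rfl⟩
      map_add' := fun x y => by
        ext g
        change (if g 1 0 = 0 then x.1 weyl + y.1 weyl else 0) =
          (if g 1 0 = 0 then x.1 weyl else 0) + (if g 1 0 = 0 then y.1 weyl else 0)
        split_ifs <;> simp
      map_smul' := fun r x => by
        ext g
        change (if g 1 0 = 0 then r • x.1 weyl else 0) = r • (if g 1 0 = 0 then x.1 weyl else 0)
        split_ifs <;> simp }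
  refine hmap_eq_zero_of_sum _ θ (fun f => ?_) n
  apply Subtype.ext
  funext h
  have hL : ((𝟙 _ - sumMap (borel F) F ≫ constMap (k := ℤ) (borel F) F :
      cosetRep ℤ (borel F) F ⟶ cosetRep ℤ (borel F) F).hom f).1 h =
      - ∑ b : F, f.1 (weyl * upper b * h) := by
    change f.1 h - (sumMap (borel F) F).hom f = _
    rw [sumMap_borel f h]
    ring
  have hR : (∑ g : SL2 F, (cosetRep ℤ (borel F) F).ρ g⁻¹ (θ ((cosetRep ℤ (borel F) F).ρ g f))).1 h =
      ∑ g : SL2 F, if (h * g⁻¹ : SL2 F) 1 0 = 0 then f.1 (weyl * g) else 0 := by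
    erw [AddSubmonoidClass.coe_finsetSum, Finset.sum_apply]
    rfl
  rw [hL, hR]
  -- Only g in the coset B h contribute; they are parametrised by the torus and the unipotent part.
  let e : Fˣ × F → SL2 F := fun x => diag x.1 * upper x.2 * h
  have he : Function.Injective e := by
    rintro ⟨t, b⟩ ⟨t', b'⟩ hx
    have hx' := mul_right_cancel hx
    rw [SL2.ext_iff'] at hx'
    simp only [SL2.mul_entry] at hx'
    simp [diag, upper] at hx'
    obtain ⟨h1, h2⟩ := hx'
    obtain rfl : t = t' := Units.ext h1
    simpa using h2
  have hinv := SL2.inv_entries (F := F)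
  refine Eq.trans ?_ (Fintype.sum_of_injective e he
    (fun x => f.1 (weyl * upper x.2 * h)) _ ?_ ?_)
  -- The summand does not depend on the torus variable, which contributes the factor q − 1 = −1 in
  -- `F`.
  · rw [Fintype.sum_prod_type]
    simp only [Finset.sum_const, Finset.card_univ, Fintype.card_units]
    rw [nsmul_eq_mul, Nat.cast_sub Fintype.card_pos]
    simp
  · intro g hg
    rw [if_neg]
    intro h0
    apply hg
    have h1 : (g * h⁻¹ : SL2 F) 1 0 = 0 := by
      obtain ⟨i1, i2, i3, i4⟩ := hinv g
      obtain ⟨j1, j2, j3, j4⟩ := hinv h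
      simp only [SL2.mul_entry, i1, i3, j1, j3] at h0 ⊢
      linear_combination - h0
    have hd := SL2.det_eq (g * h⁻¹)
    rw [h1, mul_zero, sub_zero] at hd
    refine ⟨(⟨(g * h⁻¹ : SL2 F) 0 0, (g * h⁻¹ : SL2 F) 1 1, hd, by rw [mul_comm, hd]⟩,
      (g * h⁻¹ : SL2 F) 0 1 * (g * h⁻¹ : SL2 F) 1 1), ?_⟩
    change _ * _ * _ = _
    rw [← eq_mul_inv_iff_mul_eq, SL2.ext_iff', h1]
    simp only [SL2.mul_entry (diag _)]
    simp [diag, upper]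
    linear_combination (g * h⁻¹ : SL2 F) 0 1 * hd
  · rintro ⟨t, b⟩
    have h1 : h * (diag t * upper b * h)⁻¹ = upper (-b) * diag t⁻¹ := by
      rw [mul_inv_eq_iff_eq_mul, ← mul_assoc, eq_comm]
      convert one_mul h
      rw [SL2.ext_iff']
      simp only [SL2.mul_entry]
      simp [diag, upper]
    have h2 : weyl * (diag t * upper b * h) = diag t⁻¹ * (weyl * upper b * h) := by
      simp only [← mul_assoc]
      congr 2
      rw [SL2.ext_iff']
      simp only [SL2.mul_entry]
      simp [diag, weyl]
    change _ = if (h * (diag t * upper b * h)⁻¹ : SL2 F) 1 0 = 0 then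
      f.1 (weyl * (diag t * upper b * h)) else 0
    rw [h1, h2, if_pos]
    · exact (f.2 ⟨diag t⁻¹, by simp [mem_borel, diag]⟩ _).symm
    · simp only [SL2.mul_entry]
      simp [diag, upper]

/-- Constant functions on `borel F \\ SL₂` induce an isomorphism on homology. -/
noncomputable def constEquiv (F : Type) [Field F] [Finite F] (n : ℕ) :
    groupHomology (Rep.trivial ℤ (SL2 F) F) (n + 1) ≃ₗ[ℤ]
      groupHomology (cosetRep ℤ (borel F) F) (n + 1) :=
  LinearEquiv.ofLinearMap (hmap (constMap (borel F) F) (n + 1)) (hmap (sumMap (borel F) F) (n + 1))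
    (by
      ext x
      have h1 := LinearMap.congr_fun (hmap_id_sub_eq_zero (F := F) n) x
      have h2 : hmap (𝟙 _) (n + 1) x = hmap ((𝟙 _ - sumMap (borel F) F ≫ constMap (k := ℤ) (borel F) F)
        + sumMap (borel F) F ≫ constMap (k := ℤ) (borel F) F) (n + 1) x := by
        rw [sub_add_cancel]
      rw [hmap_add, LinearMap.add_apply, h1, LinearMap.zero_apply, zero_add, hmap_id, hmap_comp] at h2
      exact h2.symm)
    (by
      ext x
      simp only [LinearMap.comp_apply]
      rw [← hmap_comp, constMap_sumMap_borel, hmap_id]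
      rfl)

/-- With coefficients in the field, `SL₂` and its Borel subgroup have the same homology. -/
noncomputable def borelEquiv (F : Type) [Field F] [Finite F] (n : ℕ) :
    groupHomology (Rep.trivial ℤ (SL2 F) F) (n + 1) ≃ₗ[ℤ]
      groupHomology (Rep.trivial ℤ (borel F) F) (n + 1) :=
  (constEquiv F n).trans (shapiro (borel F) F (n + 1))

end SL2

/-! ### The p-part as p-torsion -/

section PPart
variable {F : Type} [Field F] [Finite F] (p : ℕ) [Fact p.Prime] [CharP F p]

/-- The unipotent subgroup is additively a power of ℤ/p, so p kills its homology, and transfer costs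
a factor of the index. As the index is prime to p, all p-power torsion is killed by p. -/
lemma index_unipotent_mul_nsmul_eq_zero (n : ℕ) (x : integralHomology (SL2 F) (n + 1)) :
    ((unipotent F).index * p) • x = 0 := by
  refine index_mul_nsmul_eq_zero (k := ℤ) (unipotent F) ℤ p (n + 1) (fun y => ?_) x
  let _ := ZMod.algebra F p
  have e : F ≃+ (Fin (Module.finrank (ZMod p) F) → ZMod p) :=
    (Module.finBasis (ZMod p) F).equivFun.toAddEquiv
  exact nsmul_eq_zero_of_mulEquiv ((unipotentEquiv F).trans (AddEquiv.toMultiplicative e)) p (n + 1)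
    (nsmul_pi_zmod_eq_zero p n _) y

lemma coprime_index_unipotent : Nat.Coprime p (unipotent F).index := by
  have h := index_unipotent (F := F)
  have hp : p ∣ Nat.card F := by
    have := Fintype.ofFinite F
    rw [Nat.card_eq_fintype_card]
    exact (CharP.cast_eq_zero_iff F p _).1 (Nat.cast_card_eq_zero F)
  rw [Nat.Prime.coprime_iff_not_dvd Fact.out]
  intro h1
  have h2 : p ∣ Nat.card F ^ 2 := dvd_pow hp two_ne_zero
  rw [← h, Nat.dvd_add_right h1] at h2
  exact (Fact.out : p.Prime).one_lt.ne' (Nat.dvd_one.1 h2)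

end PPart

section PrimaryComponent
variable {A : Type*} [AddCommGroup A] {p m : ℕ}

lemma mem_primaryComponent_iff (hm : p.Coprime m) (h : ∀ x : A, (m * p) • x = 0) (x : A) :
    x ∈ AddCommGroup.primaryComponent A p ↔ p • x = 0 := by
  constructor
  · rintro ⟨n, hn⟩
    have h1 : m • p • x = 0 := by rw [← mul_smul, h]
    have h2 : p ^ n • p • x = 0 := by
      rw [smul_comm, hn, smul_zero]
    have h3 := addOrderOf_dvd_of_nsmul_eq_zero h1
    have h4 := addOrderOf_dvd_of_nsmul_eq_zero h2
    have := Nat.dvd_gcd h4 h3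
    rw [Nat.Coprime.gcd_eq_one (hm.pow_left n), Nat.dvd_one, AddMonoid.addOrderOf_eq_one_iff] at this
    exact this
  · intro hx
    exact ⟨1, by simpa using hx⟩

/-- The cokernel of multiplication by `p` has the same order as the `p`-primary component. -/
lemma card_quotient_eq_card_primaryComponent (hm : p.Coprime m) (h : ∀ x : A, (m * p) • x = 0) :
    Nat.card (A ⧸ (nsmulAddMonoidHom p : A →+ A).range) =
      Nat.card (AddCommGroup.primaryComponent A p) := by
  let f : A →+ AddCommGroup.primaryComponent A p :=
    (nsmulAddMonoidHom m : A →+ A).codRestrict _ fun x => by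
      rw [mem_primaryComponent_iff hm h]
      change p • m • x = 0
      rw [← mul_smul, mul_comm, h]
  -- Bézout splits x into a p-primary part and a multiple of p; multiplication by m then has image
  -- the p-primary part and kernel pA.
  have hbez : ∀ x : A, x = (Nat.gcdB p m) • m • x + (Nat.gcdA p m) • p • x := fun x => by
    have h1 := Nat.gcd_eq_gcd_ab p m
    rw [hm.gcd_eq_one] at h1
    rw [← natCast_zsmul x m, ← natCast_zsmul x p, ← mul_smul, ← mul_smul, ← add_smul]
    rw [show Nat.gcdB p m * (m : ℤ) + Nat.gcdA p m * (p : ℤ) = 1 by push_cast at h1; linarith, one_smul]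
  have hf : Function.Surjective f := fun x => by
    refine ⟨Nat.gcdB p m • x.1, Subtype.ext ?_⟩
    change m • Nat.gcdB p m • x.1 = x.1
    have h1 := hbez x.1
    rw [(mem_primaryComponent_iff hm h x.1).1 x.2, smul_zero, add_zero] at h1
    rw [smul_comm]
    exact h1.symm
  have hk : f.ker = (nsmulAddMonoidHom p : A →+ A).range := by
    ext x
    rw [AddMonoidHom.mem_ker, AddMonoidHom.mem_range]
    constructor
    · intro hx
      have hx' : m • x = 0 := congrArg Subtype.val hx
      refine ⟨Nat.gcdA p m • x, ?_⟩
      change p • Nat.gcdA p m • x = x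
      have h1 := hbez x
      rw [hx', smul_zero, zero_add] at h1
      rw [smul_comm]
      exact h1.symm
    · rintro ⟨y, rfl⟩
      apply Subtype.ext
      change m • p • y = 0
      rw [← mul_smul, h]
  rw [← hk]
  exact Nat.card_congr (QuotientAddGroup.quotientKerEquivOfSurjective f hf).toEquiv

end PrimaryComponent

/-! ### Homology from a minimal acyclic resolution -/

section Resolution
variable {k G : Type} [CommRing k] [Group G]

lemma zero_surjective {A B : Rep.{0} k G} (φ : A ⟶ B)
    (h : Function.Surjective φ.hom) : Function.Surjective (hmap φ 0) := by
  intro y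
  obtain ⟨x, hx⟩ : ∃ x, Representation.Coinvariants.map _ _ φ.hom x = zeroEquiv B y := by
    induction zeroEquiv B y using Representation.Coinvariants.induction_on with | _ b
    obtain ⟨a, rfl⟩ := h b
    exact ⟨Representation.Coinvariants.mk _ a, rfl⟩
  refine ⟨(zeroEquiv A).symm x, (zeroEquiv B).injective ?_⟩
  rw [zeroEquiv_hmap, LinearEquiv.apply_symm_apply, hx]

/-- Homology can be computed from a resolution by modules with vanishing homology whose
differentials vanish on coinvariants. -/
theorem card_groupHomology_eq_of_minimal (Z P : ℕ → Rep.{0} k G) (ι : ∀ n, Z (n + 1) ⟶ P n)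
    (π : ∀ n, P n ⟶ Z n) (hι : ∀ n, Function.Injective (ι n).hom)
    (hπ : ∀ n, Function.Surjective (π n).hom)
    (hex : ∀ n b, (π n).hom b = 0 ↔ ∃ a, (ι n).hom a = b)
    (hP : ∀ n k, Subsingleton (groupHomology (P n) (k + 1)))
    (hmin : ∀ n x, Representation.Coinvariants.mk (P n).ρ ((ι n).hom x) = 0) (n : ℕ) :
    Nat.card (groupHomology (Z 0) (n + 1)) = Nat.card (P (n + 1)).ρ.Coinvariants := by
  choose δ h1 h2 h3 using fun n => exists_longExact (ι n) (π n) (hι n) (hπ n) (hex n)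
  have hzero : ∀ n x, hmap (ι n) 0 x = 0 := fun n x => by
    apply (zeroEquiv _).injective
    rw [zeroEquiv_hmap, map_zero]
    induction zeroEquiv _ x using Representation.Coinvariants.induction_on with | _ b
    exact hmin n b
  have hδinj : ∀ n k, Function.Injective (δ n k) := fun n k => by
    rw [injective_iff_map_eq_zero]
    intro x hx
    obtain ⟨y, rfl⟩ := (h2 n k x).1 hx
    have := hP n k
    rw [Subsingleton.elim y 0, map_zero]
  -- Minimality is what makes the connecting map onto H₀ surjective; above degree zero acyclicity
  -- suffices. The shift therefore runs all the way down to H₀ of a syzygy.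
  have hδsurj : ∀ n k, Function.Surjective (δ n k) := fun n k x => by
    refine (h3 n k x).1 ?_
    cases k with
    | zero => exact hzero n x
    | succ k =>
      have := hP n k
      exact Subsingleton.elim _ _
  have hstep : ∀ n m, Nat.card (groupHomology (Z m) n) = Nat.card (groupHomology (Z (m + n)) 0) := by
    intro n
    induction n with
    | zero => intro m; rfl
    | succ n ih =>
      intro m
      rw [Nat.card_congr (Equiv.ofBijective _ ⟨hδinj m n, hδsurj m n⟩), ih, Nat.add_right_comm, Nat.add_assoc]
  have hπinj : Function.Injective (hmap (π (n + 1)) 0) := by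
    rw [injective_iff_map_eq_zero]
    intro x hx
    obtain ⟨y, rfl⟩ := (h1 (n + 1) 0 x).1 hx
    exact hzero _ y
  rw [hstep, zero_add, ← Nat.card_congr (Equiv.ofBijective _ ⟨hπinj, zero_surjective _ (hπ _)⟩)]
  exact Nat.card_congr (zeroEquiv _).toEquiv

end Resolution
end GroupHomologyZ

namespace TruncatedKoszul

/-! ### Contracting homotopies for truncated Koszul complexes -/

section Ring
variable {R ι : Type*} [Ring R] [DecidableEq ι] (d s π : ι → R)

/-- A contracting homotopy for a sum of anticommuting differentials, assembled from contracting
homotopies `s i` of the individual differentials onto the images of `π i`. -/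
lemma exists_homotopy (hds : ∀ i, d i * s i + s i * d i = 1 - π i)
    (hds' : ∀ i j, i ≠ j → d i * s j + s j * d i = 0)
    (hdπ' : ∀ i j, i ≠ j → d i * π j = π j * d i)
    (hdπ : ∀ i, d i * π i = 0) (hπd : ∀ i, π i * d i = 0)
    (C : Finset ι → R → Prop) (hC0 : C ∅ 1) (hC : ∀ i t x, i ∉ t → C t x → C (insert i t) (π i * x))
    (t : Finset ι) : ∃ h x, C t x ∧ (∑ i ∈ t, d i) * h + h * (∑ i ∈ t, d i) = 1 - x ∧
      ∀ j ∉ t, d j * h + h * d j = 0 := by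
  induction t using Finset.induction_on with
  | empty => exact ⟨0, 1, hC0, by simp, by simp⟩
  | insert i t hi ih =>
    obtain ⟨h, x, hx, h1, h2⟩ := ih
    -- The usual homotopy on a tensor product: contract direction i, and use the previous homotopy
    -- on what `π i` leaves. The predicate `C` carries information about the product of the
    -- projections through the induction.
    refine ⟨s i + π i * h, π i * x, hC i t x hi hx, ?_, fun j hj => ?_⟩
    · rw [Finset.sum_insert hi]
      set D := ∑ i ∈ t, d i
      have e1 : D * s i + s i * D = 0 := by
        rw [Finset.sum_mul, Finset.mul_sum, ← Finset.sum_add_distrib]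
        exact Finset.sum_eq_zero fun j hj => hds' j i fun h => hi (h ▸ hj)
      have e2 : D * π i = π i * D := by
        rw [Finset.sum_mul, Finset.mul_sum]
        exact Finset.sum_congr rfl fun j hj => hdπ' j i fun h => hi (h ▸ hj)
      calc (d i + D) * (s i + π i * h) + (s i + π i * h) * (d i + D)
          = (d i * s i + s i * d i) + (d i * π i) * h + (D * s i + s i * D) + (D * π i) * h
            + π i * h * D + π i * (d i * h + h * d i) - (π i * d i) * h := by noncomm_ring
        _ = 1 - π i + π i * (D * h + h * D) := by
            rw [hds, hdπ, hπd, e1, e2, h2 i hi]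
            noncomm_ring
        _ = 1 - π i * x := by rw [h1]; noncomm_ring
    · rw [Finset.mem_insert, not_or] at hj
      have e3 := hdπ' j i hj.1
      calc d j * (s i + π i * h) + (s i + π i * h) * d j
          = (d j * s i + s i * d j) + (d j * π i) * h + π i * h * d j := by noncomm_ring
        _ = (d j * s i + s i * d j) + π i * (d j * h + h * d j) := by rw [e3]; noncomm_ring
        _ = 0 := by rw [hds' j i hj.1, h2 j hj.2]; simp

end Ring

section Operators
variable {K A : Type*} [CommRing K] [AddCommGroup A] [Module K A] {f : ℕ} (p : ℕ)
  (D S : Fin f → Module.End K A)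

/-- The alternating exponents `1, p - 1, 1, p - 1, …`. -/
def step (b : ℕ) : ℕ := if Even b then 1 else p - 1

/-- The Koszul sign. -/
def sign (K : Type*) [CommRing K] {f : ℕ} (i : Fin f) (α : Fin f → ℕ) : K :=
  (-1) ^ ∑ j ∈ Finset.Iio i, α j

lemma sign_mul_self (i : Fin f) (α : Fin f → ℕ) : sign K i α * sign K i α = 1 := by
  rw [sign, ← mul_pow]
  simp

lemma sign_add_single (i j : Fin f) (α : Fin f → ℕ) :
    sign K i (α + Pi.single j 1) = if j < i then - sign K i α else sign K i α := by
  have h1 : ∑ k ∈ Finset.Iio i, (Pi.single j 1 : Fin f → ℕ) k = if j < i then 1 else 0 := by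
    simp
  simp only [sign, Pi.add_apply, Finset.sum_add_distrib, pow_add]
  rw [h1]
  split_ifs <;> simp

/-- The differential in the direction `i`. -/
def diff (i : Fin f) : Module.End K ((Fin f → ℕ) → A) where
  toFun φ β := sign K i β • (D i ^ step p (β i)) (φ (β + Pi.single i 1))
  map_add' φ ψ := by ext; simp
  map_smul' c φ := by
    ext
    simp only [Pi.smul_apply, map_smul, RingHom.id_apply]
    rw [smul_comm]

/-- The homotopy in the direction `i`. -/
def homot (i : Fin f) : Module.End K ((Fin f → ℕ) → A) where
  toFun φ α := if α i = 0 then 0 else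
    sign K i (α - Pi.single i 1) • (S i ^ step p (α i - 1)) (φ (α - Pi.single i 1))
  map_add' φ ψ := by ext α; by_cases h : α i = 0 <;> simp [h]
  map_smul' c φ := by
    ext α
    by_cases h : α i = 0
    · simp [h]
    · simp only [Pi.smul_apply, map_smul, RingHom.id_apply, if_neg h]
      rw [smul_comm]

/-- The projection in the direction `i`. -/
def proj (i : Fin f) : Module.End K ((Fin f → ℕ) → A) where
  toFun φ α := if α i = 0 then (S i ^ (p - 1) * D i ^ (p - 1)) (φ α) else 0
  map_add' φ ψ := by ext α; by_cases h : α i = 0 <;> simp [h]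
  map_smul' c φ := by ext α; by_cases h : α i = 0 <;> simp [h]

variable {p D S}

lemma homot_zero (i : Fin f) (φ : (Fin f → ℕ) → A) (α : Fin f → ℕ) (h : α i = 0) :
    homot p S i φ α = 0 := if_pos h

lemma homot_add (i : Fin f) (φ : (Fin f → ℕ) → A) (α : Fin f → ℕ) :
    homot p S i φ (α + Pi.single i 1) = sign K i α • (S i ^ step p (α i)) (φ α) := by
  simp [homot]

lemma exists_eq_add_single (i : Fin f) (α : Fin f → ℕ) (h : α i ≠ 0) :
    ∃ β : Fin f → ℕ, α = β + Pi.single i 1 := by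
  refine ⟨α - Pi.single i 1, (tsub_add_cancel_of_le fun j => ?_).symm⟩
  by_cases hj : j = i
  · subst hj
    simpa using Nat.one_le_iff_ne_zero.2 h
  · simp [hj]

/-- In one direction the complex alternates D and D^(p−1), and S, S^(p−1) contract it. Only degree
zero leaves a defect, 1 − DS = S^(p−1) D^(p−1). -/
lemma diff_homot (hDS : ∀ i, D i * S i + S i ^ (p - 1) * D i ^ (p - 1) = 1)
    (hSD : ∀ i, D i ^ (p - 1) * S i ^ (p - 1) + S i * D i = 1) (i : Fin f) :
    diff p D i * homot p S i + homot p S i * diff p D i = 1 - proj p D S i := by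
  refine LinearMap.ext fun φ => funext fun α => ?_
  have h1 : (diff p D i * homot p S i) φ α = (D i ^ step p (α i) * S i ^ step p (α i)) (φ α) := by
    change sign K i α • (D i ^ step p (α i)) (homot p S i φ (α + Pi.single i 1)) = _
    rw [homot_add, map_smul, smul_smul, sign_mul_self, one_smul]
    rfl
  rw [LinearMap.add_apply, Pi.add_apply, h1]
  change _ + homot p S i (diff p D i φ) α = φ α - proj p D S i φ α
  by_cases h : α i = 0
  · have h2 : proj p D S i φ α = (S i ^ (p - 1) * D i ^ (p - 1)) (φ α) := if_pos h
    rw [homot_zero _ _ _ h, h2, h, add_zero, eq_sub_iff_add_eq]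
    have := LinearMap.congr_fun (hDS i) (φ α)
    simpa [step] using this
  · have h2 : proj p D S i φ α = 0 := if_neg h
    rw [h2, sub_zero]
    obtain ⟨β, rfl⟩ := exists_eq_add_single i α h
    rw [homot_add]
    change _ + sign K i β • (S i ^ step p (β i)) (sign K i β • (D i ^ step p (β i)) (φ _)) = _
    rw [map_smul, smul_smul, sign_mul_self, one_smul]
    by_cases hb : Even (β i)
    · have := LinearMap.congr_fun (hSD i) (φ (β + Pi.single i 1))
      simpa [step, hb, Nat.even_add_one] using this
    · have := LinearMap.congr_fun (hDS i) (φ (β + Pi.single i 1))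
      simpa [step, hb, Nat.even_add_one] using this

lemma add_single_comm (i j : Fin f) (α : Fin f → ℕ) :
    α + Pi.single i 1 + Pi.single j 1 = α + Pi.single j 1 + Pi.single i 1 := add_right_comm _ _ _

lemma diff_homot_of_ne (hc : ∀ i j, i ≠ j → Commute (D i) (S j)) (i j : Fin f) (hij : i ≠ j) :
    diff p D i * homot p S j + homot p S j * diff p D i = 0 := by
  refine LinearMap.ext fun φ => funext fun α => ?_
  change sign K i α • (D i ^ step p (α i)) (homot p S j φ (α + Pi.single i 1)) +
    homot p S j (diff p D i φ) α = 0
  by_cases h : α j = 0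
  · rw [homot_zero _ _ _ h, homot_zero _ _ _ (by simp [h, hij.symm])]
    simp
  · obtain ⟨β, rfl⟩ := exists_eq_add_single j α h
    rw [homot_add, add_single_comm, homot_add]
    change _ + _ • (S j ^ _) (sign K i β • (D i ^ step p (β i)) (φ (β + Pi.single i 1))) = 0
    have hcc := ((hc i j hij).pow_pow (step p (β i)) (step p (β j)))
    have hcc' := LinearMap.congr_fun hcc.eq (φ (β + Pi.single i 1))
    simp only [Module.End.mul_apply] at hcc'
    simp only [map_smul, smul_smul, sign_add_single, Pi.add_apply, Pi.single_eq_of_ne hij,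
      Pi.single_eq_of_ne hij.symm, add_zero, hcc', ← add_smul]
    rcases lt_or_gt_of_ne hij with h1 | h1
    · rw [if_pos h1, if_neg h1.not_gt]
      ring_nf
      simp
    · rw [if_pos h1, if_neg h1.not_gt]
      ring_nf
      simp

lemma diff_proj_of_ne (hc : ∀ i j, i ≠ j → Commute (D i) (S j)) (hd : ∀ i j, Commute (D i) (D j))
    (i j : Fin f) (hij : i ≠ j) :
    diff p D i * proj p D S j = proj p D S j * diff p D i := by
  refine LinearMap.ext fun φ => funext fun α => ?_
  change sign K i α • (D i ^ step p (α i)) (proj p D S j φ (α + Pi.single i 1)) =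
    if α j = 0 then (S j ^ (p - 1) * D j ^ (p - 1)) (diff p D i φ α) else 0
  have h1 : (α + Pi.single i 1 : Fin f → ℕ) j = α j := by simp [hij.symm]
  by_cases h : α j = 0
  · have h2 : proj p D S j φ (α + Pi.single i 1) = (S j ^ (p - 1) * D j ^ (p - 1)) (φ (α + Pi.single i 1)) :=
      if_pos (h1.trans h)
    have hcc : Commute (D i ^ step p (α i)) (S j ^ (p - 1) * D j ^ (p - 1)) :=
      ((hc i j hij).pow_pow _ _).mul_right ((hd i j).pow_pow _ _)
    rw [h2, if_pos h]
    change _ = (S j ^ (p - 1) * D j ^ (p - 1)) (sign K i α • (D i ^ step p (α i)) _)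
    rw [map_smul]
    congr 1
    exact LinearMap.congr_fun hcc.eq _
  · have h2 : proj p D S j φ (α + Pi.single i 1) = 0 := if_neg (by rwa [h1])
    rw [h2, if_neg h]
    simp

lemma diff_proj (i : Fin f) : diff p D i * proj p D S i = 0 := by
  refine LinearMap.ext fun φ => funext fun α => ?_
  change sign K i α • (D i ^ step p (α i)) (proj p D S i φ (α + Pi.single i 1)) = 0
  have h2 : proj p D S i φ (α + Pi.single i 1) = 0 := if_neg (by simp)
  rw [h2]
  simp

lemma proj_diff (hp : 1 ≤ p) (hD : ∀ i, D i ^ p = 0) (i : Fin f) :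
    proj p D S i * diff p D i = 0 := by
  refine LinearMap.ext fun φ => funext fun α => ?_
  change (if α i = 0 then (S i ^ (p - 1) * D i ^ (p - 1))
    (sign K i α • (D i ^ step p (α i)) (φ (α + Pi.single i 1))) else 0) = 0
  split_ifs with h
  · have h1 : D i ^ (p - 1) * D i = 0 := by rw [← pow_succ, Nat.sub_add_cancel hp, hD]
    have h2 := LinearMap.congr_fun h1 (φ (α + Pi.single i 1))
    simp only [Module.End.mul_apply, LinearMap.zero_apply] at h2
    simp [h, step, h2]
  · rfl

/-- Two consecutive exponents in one direction add up to p, and the Koszul signs cancel the mixed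
terms. -/
lemma diff_diff (hp : 1 ≤ p) (hD : ∀ i, D i ^ p = 0) (hd : ∀ i j, Commute (D i) (D j)) :
    (∑ i, diff p D i) * (∑ i, diff p D i) = 0 := by
  have h1 : ∀ i, diff p D i * diff p D i = 0 := fun i => by
    refine LinearMap.ext fun φ => funext fun α => ?_
    change sign K i α • (D i ^ step p (α i)) (sign K i (α + Pi.single i 1) •
      (D i ^ step p ((α + Pi.single i 1 : Fin f → ℕ) i)) (φ (α + Pi.single i 1 + Pi.single i 1))) = 0
    have h2 : D i ^ step p (α i) * D i ^ step p ((α + Pi.single i 1 : Fin f → ℕ) i) = 0 := by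
      rw [← pow_add, ← hD i]
      congr 1
      by_cases hb : Even (α i)
      · simp [step, hb, Nat.even_add_one]
        omega
      · simp [step, hb, Nat.even_add_one]
        omega
    have h3 := LinearMap.congr_fun h2 (φ (α + Pi.single i 1 + Pi.single i 1))
    simp only [Module.End.mul_apply, LinearMap.zero_apply] at h3
    rw [map_smul, h3]
    simp
  have h2 : ∀ i j, i ≠ j → diff p D i * diff p D j + diff p D j * diff p D i = 0 := fun i j hij => by
    refine LinearMap.ext fun φ => funext fun α => ?_
    change sign K i α • (D i ^ step p (α i)) (sign K j (α + Pi.single i 1) •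
      (D j ^ step p ((α + Pi.single i 1 : Fin f → ℕ) j)) (φ (α + Pi.single i 1 + Pi.single j 1))) +
      sign K j α • (D j ^ step p (α j)) (sign K i (α + Pi.single j 1) •
      (D i ^ step p ((α + Pi.single j 1 : Fin f → ℕ) i)) (φ (α + Pi.single j 1 + Pi.single i 1))) = 0
    have hcc' := LinearMap.congr_fun ((hd i j).pow_pow (step p (α i)) (step p (α j))).eq
      (φ (α + Pi.single j 1 + Pi.single i 1))
    simp only [Module.End.mul_apply] at hcc'
    rw [add_single_comm]
    simp only [map_smul, smul_smul, sign_add_single, Pi.add_apply, Pi.single_eq_of_ne hij,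
      Pi.single_eq_of_ne hij.symm, add_zero, hcc', ← add_smul]
    rcases lt_or_gt_of_ne hij with h1 | h1
    · rw [if_pos h1, if_neg h1.not_gt]
      ring_nf
      simp
    · rw [if_pos h1, if_neg h1.not_gt]
      ring_nf
      simp
  have key : ∀ t : Finset (Fin f), (∑ i ∈ t, diff p D i) * (∑ i ∈ t, diff p D i) = 0 := fun t => by
    induction t using Finset.induction_on with
    | empty => simp
    | insert i t hi ih =>
      rw [Finset.sum_insert hi]
      set E := ∑ i ∈ t, diff p D i
      have e1 : diff p D i * E + E * diff p D i = 0 := by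
        rw [Finset.sum_mul, Finset.mul_sum, ← Finset.sum_add_distrib]
        exact Finset.sum_eq_zero fun j hj => h2 i j fun h => hi (h ▸ hj)
      calc (diff p D i + E) * (diff p D i + E) =
          diff p D i * diff p D i + (diff p D i * E + E * diff p D i) + E * E := by noncomm_ring
        _ = 0 := by rw [h1, e1, ih]; simp
  exact key _

/-- Exactness of the total complex: a cycle is a boundary up to an element concentrated in degree
zero and killed by all `S i`. -/
theorem exists_eq_diff_add (hp : 1 ≤ p)
    (hDS : ∀ i, D i * S i + S i ^ (p - 1) * D i ^ (p - 1) = 1)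
    (hSD : ∀ i, D i ^ (p - 1) * S i ^ (p - 1) + S i * D i = 1)
    (hD : ∀ i, D i ^ p = 0) (hS : ∀ i, S i ^ p = 0) (hd : ∀ i j, Commute (D i) (D j))
    (hs : ∀ i j, Commute (S i) (S j))
    (hc : ∀ i j, i ≠ j → Commute (D i) (S j)) (φ : (Fin f → ℕ) → A)
    (hφ : (∑ i, diff p D i) φ = 0) :
    ∃ ψ χ : (Fin f → ℕ) → A, φ = (∑ i, diff p D i) ψ + χ ∧ (∀ α, α ≠ 0 → χ α = 0) ∧
      (∀ α, φ α = 0 → χ α = 0) ∧ ∀ i, S i (χ 0) = 0 := by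
  obtain ⟨h, x, ⟨e, hx, he⟩, h1, -⟩ := exists_homotopy (diff p D) (homot p S) (proj p D S)
    (diff_homot hDS hSD) (diff_homot_of_ne hc) (diff_proj_of_ne hc hd) diff_proj (proj_diff hp hD)
    -- The product of projections over t is supported where α vanishes on t, with values killed by
    -- S_i for i in t, since S_i · S_i^(p−1) = 0.
    (fun t x => ∃ e : Module.End K A, (∀ φ α, x φ α = if ∀ i ∈ t, α i = 0 then e (φ α) else 0) ∧
      ∀ i ∈ t, S i * e = 0) ⟨1, by simp, by simp⟩ (fun i t x hi ⟨e, hx, he⟩ =>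
        ⟨S i ^ (p - 1) * D i ^ (p - 1) * e, fun φ α => by
          change (if α i = 0 then (S i ^ (p - 1) * D i ^ (p - 1)) (x φ α) else 0) = _
          rw [hx]
          simp only [Finset.forall_mem_insert]
          by_cases h1 : α i = 0
          · by_cases h2 : ∀ j ∈ t, α j = 0
            · rw [if_pos h1, if_pos h2, if_pos ⟨h1, h2⟩]
              rfl
            · rw [if_neg h2, map_zero, ite_self, if_neg fun h => h2 h.2]
          · rw [if_neg h1, if_neg fun h => h1 h.1], fun j hj => by
          rcases Finset.mem_insert.1 hj with rfl | hj
          · rw [← mul_assoc, ← mul_assoc, ← pow_succ', Nat.sub_add_cancel hp, hS]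
            simp
          · have hji : j ≠ i := fun h => hi (h ▸ hj)
            have : Commute (S j) (S i ^ (p - 1) * D i ^ (p - 1)) :=
              ((hs j i).pow_right _).mul_right ((hc i j hji.symm).symm.pow_right _)
            rw [← mul_assoc, this.eq, mul_assoc, he j hj, mul_zero]⟩) Finset.univ
  refine ⟨h φ, x φ, ?_, fun α hα => ?_, fun α hα => ?_, fun i => ?_⟩
  · have := LinearMap.congr_fun h1 φ
    simp only [LinearMap.add_apply, Module.End.mul_apply, hφ, map_zero, add_zero,
      LinearMap.sub_apply, Module.End.one_apply] at this
    rw [this]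
    simp
  · rw [hx, if_neg]
    intro h0
    exact hα (funext fun i => h0 i (Finset.mem_univ i))
  · rw [hx, hα]
    simp
  · rw [hx, if_pos (by simp)]
    exact LinearMap.congr_fun (he i (Finset.mem_univ i)) _

end Operators

/-! ### Jordan blocks acting on one tensor factor -/

section CoordOp
variable {K ι X : Type*} [CommRing K] [Fintype X] [DecidableEq ι] [DecidableEq X]

/-- A matrix acting on one coordinate of a function on a product. -/
def coordOp (i : ι) : Matrix X X K →+* Module.End K ((ι → X) → K) where
  toFun N :=
    { toFun := fun c m => ∑ x, N (m i) x * c (Function.update m i x)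
      map_add' := fun c d => by ext m; simp [mul_add, Finset.sum_add_distrib]
      map_smul' := fun r c => by ext m; simp [Finset.mul_sum, mul_left_comm] }
  map_one' := by
    ext c m
    simp [Matrix.one_apply]
  map_zero' := by
    ext c m
    simp
  map_add' N N' := by
    refine LinearMap.ext fun c => funext fun m => ?_
    simp [add_mul, Finset.sum_add_distrib]
  map_mul' N N' := by
    refine LinearMap.ext fun c => funext fun m => ?_
    simp only [Matrix.mul_apply, Module.End.mul_apply, LinearMap.coe_mk, AddHom.coe_mk,
      Function.update_self, Function.update_idem, Finset.mul_sum, Finset.sum_mul]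
    rw [Finset.sum_comm]
    simp only [mul_assoc]

lemma coordOp_apply (i : ι) (N : Matrix X X K) (c : (ι → X) → K) (m : ι → X) :
    coordOp i N c m = ∑ x, N (m i) x * c (Function.update m i x) := rfl

lemma coordOp_commute {i j : ι} (hij : i ≠ j) (N N' : Matrix X X K) :
    Commute (coordOp i N) (coordOp j N') := by
  refine LinearMap.ext fun c => funext fun m => ?_
  simp only [Module.End.mul_apply, coordOp_apply, Finset.mul_sum,
    Function.update_of_ne hij, Function.update_of_ne hij.symm]
  rw [Finset.sum_comm]
  refine Finset.sum_congr rfl fun x _ => Finset.sum_congr rfl fun y _ => ?_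
  rw [Function.update_comm hij]
  ring

end CoordOp

section Shift
variable (K : Type*) [CommRing K] (p : ℕ)

/-- The nilpotent Jordan block. -/
def shift : Matrix (Fin p) (Fin p) K := fun a b => if (a : ℕ) + 1 = b then 1 else 0

variable {K p}

lemma shift_pow (k : ℕ) : shift K p ^ k =
    Matrix.of fun a b : Fin p => if (a : ℕ) + k = b then 1 else 0 := by
  induction k with
  | zero =>
    ext a b
    simp [Matrix.one_apply, Fin.ext_iff]
  | succ k ih =>
    ext a b
    rw [pow_succ, ih, Matrix.mul_apply]
    simp only [shift, Matrix.of_apply]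
    by_cases h : (a : ℕ) + (k + 1) = b
    · rw [Finset.sum_eq_single ⟨a + k, by omega⟩ _ (by simp)]
      · simp [← h, add_assoc]
      · intro c _ hc
        rw [if_neg, zero_mul]
        intro h1
        exact hc (Fin.ext h1.symm)
    · rw [if_neg h]
      refine Finset.sum_eq_zero fun c _ => ?_
      by_cases h1 : (a : ℕ) + k = c
      · rw [if_neg (show ¬ (c : ℕ) + 1 = b by omega), mul_zero]
      · rw [if_neg h1, zero_mul]

lemma shift_pow_self : shift K p ^ p = 0 := by
  rw [shift_pow]
  ext a b
  exact if_neg (by omega)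

/-- The first term is the identity except in the last coordinate; the second is the projection onto
that coordinate. In `transpose_mul_shift` the first coordinate plays this role. -/
lemma shift_mul_transpose (hp : 1 ≤ p) : shift K p * (shift K p).transpose +
    (shift K p).transpose ^ (p - 1) * shift K p ^ (p - 1) = 1 := by
  rw [← Matrix.transpose_pow, shift_pow]
  ext a b
  rw [Matrix.add_apply, Matrix.mul_apply, Matrix.mul_apply, Matrix.one_apply]
  simp only [Matrix.transpose_apply, shift, Matrix.of_apply]
  by_cases hab : a = b
  · subst hab
    rw [if_pos rfl]
    by_cases h : (a : ℕ) + 1 = p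
    · rw [Finset.sum_eq_zero, Finset.sum_eq_single ⟨0, by omega⟩ _ (by simp)]
      · rw [if_pos (show 0 + (p - 1) = (a : ℕ) by omega)]
        simp
      · intro c _ hc
        rw [if_neg, zero_mul]
        intro h1
        exact hc (Fin.ext (show (c : ℕ) = 0 by omega))
      · intro c _
        rw [if_neg (by omega), zero_mul]
    · rw [Finset.sum_eq_single ⟨a + 1, by omega⟩ _ (by simp), Finset.sum_eq_zero]
      · simp
      · intro c _
        rw [if_neg (by omega), zero_mul]
      · intro c _ hc
        rw [if_neg, zero_mul]
        intro h1
        exact hc (Fin.ext h1.symm)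
  · have hab' : (a : ℕ) ≠ b := fun h => hab (Fin.ext h)
    rw [if_neg hab, Finset.sum_eq_zero, Finset.sum_eq_zero, add_zero]
    · intro c _
      by_cases h1 : (c : ℕ) + (p - 1) = a
      · rw [if_neg (show ¬ (c : ℕ) + (p - 1) = b by omega), mul_zero]
      · rw [if_neg h1, zero_mul]
    · intro c _
      by_cases h1 : (a : ℕ) + 1 = c
      · rw [if_neg (show ¬ (b : ℕ) + 1 = c by omega), mul_zero]
      · rw [if_neg h1, zero_mul]

lemma transpose_mul_shift (hp : 1 ≤ p) : shift K p ^ (p - 1) * (shift K p).transpose ^ (p - 1) +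
    (shift K p).transpose * shift K p = 1 := by
  rw [← Matrix.transpose_pow, shift_pow]
  ext a b
  rw [Matrix.add_apply, Matrix.mul_apply, Matrix.mul_apply, Matrix.one_apply]
  simp only [Matrix.transpose_apply, shift, Matrix.of_apply]
  by_cases hab : a = b
  · subst hab
    rw [if_pos rfl]
    by_cases h : (a : ℕ) = 0
    · rw [add_comm, Finset.sum_eq_zero, Finset.sum_eq_single ⟨p - 1, by omega⟩ _ (by simp)]
      · simp [h]
      · intro c _ hc
        rw [if_neg, zero_mul]
        intro h1
        exact hc (Fin.ext (show (c : ℕ) = p - 1 by omega))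
      · intro c _
        rw [if_neg (by omega), zero_mul]
    · rw [add_comm, Finset.sum_eq_single ⟨a - 1, by omega⟩ _ (by simp), Finset.sum_eq_zero]
      · rw [if_pos (show (a : ℕ) - 1 + 1 = a by omega)]
        simp
      · intro c _
        rw [if_neg (by omega), zero_mul]
      · intro c _ hc
        rw [if_neg, zero_mul]
        intro h1
        exact hc (Fin.ext (show (c : ℕ) = a - 1 by omega))
  · have hab' : (a : ℕ) ≠ b := fun h => hab (Fin.ext h)
    rw [if_neg hab, Finset.sum_eq_zero, Finset.sum_eq_zero, add_zero]
    · intro c _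
      by_cases h1 : (c : ℕ) + 1 = a
      · rw [if_neg (show ¬ (c : ℕ) + 1 = b by omega), mul_zero]
      · rw [if_neg h1, zero_mul]
    · intro c _
      by_cases h1 : (a : ℕ) + (p - 1) = c
      · rw [if_neg (show ¬ (b : ℕ) + (p - 1) = c by omega), mul_zero]
      · rw [if_neg h1, zero_mul]

end Shift

/-! ### Hasse derivatives on functions on a finite field -/

section FiniteField
variable {F : Type} [Field F] [Fintype F]

lemma sum_eq_sum_units {M : Type*} [AddCommMonoid M] [Fintype Fˣ] (g : F → M)
    (h : g 0 = 0) : ∑ c, g c = ∑ u : Fˣ, g u := by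
  classical
  refine (Fintype.sum_of_injective Units.val Units.val_injective _ _ (fun c hc => ?_) fun u => rfl).symm
  rw [show c = 0 from by_contra fun h0 => hc ⟨Units.mk0 c h0, rfl⟩, h]

lemma sum_inv_pow_mul_pow (k l : ℕ) (hk : 1 ≤ k) (hk' : k < Fintype.card F) (hl : 1 ≤ l)
    (hl' : l < Fintype.card F) :
    ∑ c : F, c⁻¹ ^ l * c ^ k = if k = l then -1 else 0 := by
  classical
  rw [sum_eq_sum_units _ (by simp [show k ≠ 0 by omega])]
  have h1 : ∀ u : Fˣ, ((u : F)⁻¹ ^ l * (u : F) ^ k) = ((u : F) ^ (Fintype.card F - 1 + k - l)) := fun u => by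
    have h2 : (u : F) ^ (Fintype.card F - 1) = 1 := FiniteField.pow_card_sub_one_eq_one _ u.ne_zero
    rw [inv_pow, inv_mul_eq_iff_eq_mul₀ (pow_ne_zero _ u.ne_zero), ← pow_add,
      show l + (Fintype.card F - 1 + k - l) = Fintype.card F - 1 + k by omega, pow_add, h2, one_mul]
  rw [Finset.sum_congr rfl fun u _ => h1 u, FiniteField.sum_pow_units]
  congr 1
  apply propext
  constructor
  · rintro ⟨m, hm⟩
    rcases m with _ | _ | m
    · omega
    · omega
    · have : Fintype.card F - 1 + k - l = (Fintype.card F - 1) * m + 2 * (Fintype.card F - 1) := by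
        rw [hm]; ring
      omega
  · rintro rfl
    rw [Nat.add_sub_cancel]

/-- The Hasse derivative of order `l`, written as a combination of translations. -/
def hasse (F : Type) [Field F] [Fintype F] (l : ℕ) : Module.End F (F → F) where
  toFun g x := - ∑ c : F, c⁻¹ ^ l * (g (x + c) - g x)
  map_add' g h := by
    ext x
    simp only [Pi.add_apply, ← neg_add, ← Finset.sum_add_distrib]
    congr 1
    refine Finset.sum_congr rfl fun c _ => by ring
  map_smul' r g := by
    ext x
    simp only [Pi.smul_apply, smul_eq_mul, RingHom.id_apply, mul_neg, Finset.mul_sum]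
    congr 1
    refine Finset.sum_congr rfl fun c _ => by ring

lemma hasse_apply (l : ℕ) (g : F → F) (x : F) :
    hasse F l g x = - ∑ c : F, c⁻¹ ^ l * (g (x + c) - g x) := rfl

/-- Expand (x + c)^M; power sums over the field pick out the coefficient of c^l. Subtracting g(x)
removes the constant term, which would otherwise interfere when l = q − 1. -/
lemma hasse_pow (l M : ℕ) (hl : 1 ≤ l) (hl' : l < Fintype.card F) (hM : M < Fintype.card F) :
    hasse F l (fun x => x ^ M) = fun x => (M.choose l : F) * x ^ (M - l) := by
  funext x
  rw [hasse_apply]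
  have h1 : ∀ c : F, c⁻¹ ^ l * ((x + c) ^ M - x ^ M) =
      ∑ k ∈ Finset.range M, (c⁻¹ ^ l * c ^ (k + 1)) * (x ^ (M - (k + 1)) * M.choose (k + 1)) := fun c => by
    rw [add_comm x c, add_pow, Finset.sum_range_succ']
    simp only [pow_zero, one_mul, Nat.sub_zero, Nat.choose_zero_right, Nat.cast_one, mul_one,
      add_sub_cancel_right, Finset.mul_sum]
    exact Finset.sum_congr rfl fun k _ => by ring
  rw [Finset.sum_congr rfl fun c _ => h1 c, Finset.sum_comm]
  simp only [← Finset.sum_mul]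
  have h2 : ∀ k ∈ Finset.range M, (∑ c : F, c⁻¹ ^ l * c ^ (k + 1)) * (x ^ (M - (k + 1)) * M.choose (k + 1)) =
      if k + 1 = l then - (x ^ (M - (k + 1)) * M.choose (k + 1)) else 0 := fun k hk => by
    have := Finset.mem_range.1 hk
    rw [sum_inv_pow_mul_pow (k + 1) l (by omega) (by omega) hl hl']
    split_ifs <;> ring
  rw [Finset.sum_congr rfl h2]
  obtain ⟨l, rfl⟩ : ∃ l', l = l' + 1 := ⟨l - 1, by omega⟩
  simp only [Nat.add_right_cancel_iff, Finset.sum_ite_eq', Finset.mem_range]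
  split_ifs with h
  · ring
  · rw [Nat.choose_eq_zero_of_lt (by omega)]
    simp

/-- Translation preserves the total sum. This gives both that the augmentation kills the image of
the differential and that the resolution is minimal. -/
lemma sum_hasse (l : ℕ) (g : F → F) : ∑ x, hasse F l g x = 0 := by
  simp only [hasse_apply, Finset.sum_neg_distrib]
  rw [Finset.sum_comm, neg_eq_zero]
  refine Finset.sum_eq_zero fun c _ => ?_
  rw [← Finset.mul_sum, Finset.sum_sub_distrib,
    Fintype.sum_equiv (Equiv.addRight c) (fun x => g (x + c)) g fun _ => rfl, sub_self, mul_zero]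

variable {p f : ℕ} [Fact p.Prime]

lemma choose_prime_pow_cast {R : Type*} [Ring R] [CharP R p] (n i : ℕ) :
    ((n.choose (p ^ i) : ℕ) : R) = ((n / p ^ i : ℕ) : R) := by
  have hp : p ≠ 0 := (Fact.out : p.Prime).ne_zero
  have h : n.choose (p ^ i) ≡ n / p ^ i [MOD p] := by
    induction i generalizing n with
    | zero => simp; rfl
    | succ i ih =>
      refine Choose.choose_modEq_choose_mod_mul_choose_div_nat.trans ?_
      rw [pow_succ', Nat.mul_mod_right, Nat.choose_zero_right, one_mul,
        Nat.mul_div_cancel_left _ (Fact.out : p.Prime).pos, ← Nat.div_div_eq_div_mul]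
      exact ih _
  exact (CharP.natCast_eq_natCast' R p h)

variable (F) in
/-- Divided monomials in the Frobenius powers of the coordinate. -/
noncomputable def dividedMonomial (m : Fin f → Fin p) (x : F) : F :=
  (∏ j, (((m j : ℕ).factorial : ℕ) : F))⁻¹ * x ^ (finFunctionFinEquiv m : ℕ)

omit [Fintype F] in
lemma prod_factorial_ne_zero [CharP F p] (m : Fin f → Fin p) :
    (∏ j, (((m j : ℕ).factorial : ℕ) : F)) ≠ 0 := by
  refine Finset.prod_ne_zero_iff.2 fun j _ => ?_
  rw [Ne, CharP.cast_eq_zero_iff F p, (Fact.out : p.Prime).dvd_factorial]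
  exact not_le.2 (m j).2

/-- By Lucas, the binomial coefficient of M over p^i is the i-th digit of M modulo p. Dividing by
the factorials of the digits absorbs it, leaving an exact Jordan block on digit i. -/
lemma hasse_dividedMonomial [CharP F p] (hF : Fintype.card F = p ^ f) (i : Fin f)
    (m : Fin f → Fin p) : hasse F (p ^ (i : ℕ)) (dividedMonomial F m) =
      ∑ y, shift F p y (m i) • dividedMonomial F (Function.update m i y) := by
  have hp : p.Prime := Fact.out
  have h1 : dividedMonomial F m = (∏ j, (((m j : ℕ).factorial : ℕ) : F))⁻¹ •
    fun x => x ^ (finFunctionFinEquiv m : ℕ) := rfl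
  have hdig : ((((finFunctionFinEquiv m : ℕ) / p ^ (i : ℕ) : ℕ)) : F) = (m i : ℕ) := by
    refine CharP.natCast_eq_natCast' F p ?_
    have := congrArg Fin.val (congrFun (finFunctionFinEquiv.symm_apply_apply m) i)
    rw [Nat.ModEq, Nat.mod_eq_of_lt (m i).2]
    exact this
  rw [h1, map_smul, hasse_pow _ _ (Nat.one_le_pow _ _ hp.pos)
    (by rw [hF]; exact Nat.pow_lt_pow_right hp.one_lt i.2)
    (by rw [hF]; exact (finFunctionFinEquiv m).2)]
  funext x
  simp only [Pi.smul_apply, smul_eq_mul, Finset.sum_apply, choose_prime_pow_cast, hdig]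
  by_cases h0 : (m i : ℕ) = 0
  · rw [h0, Finset.sum_eq_zero]
    · simp
    · intro y _
      rw [shift, if_neg (by omega), zero_mul]
  · obtain ⟨y, hy⟩ : ∃ y : Fin p, (y : ℕ) + 1 = m i := ⟨⟨m i - 1, by omega⟩, by simp; omega⟩
    rw [Finset.sum_eq_single y]
    · rw [shift, if_pos hy, one_mul, dividedMonomial]
      have hcode : (finFunctionFinEquiv m : ℕ) =
          (finFunctionFinEquiv (Function.update m i y) : ℕ) + p ^ (i : ℕ) := by
        rw [finFunctionFinEquiv_apply, finFunctionFinEquiv_apply,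
          Fintype.sum_eq_add_sum_compl i, Fintype.sum_eq_add_sum_compl i, ← hy,
          Finset.sum_congr rfl fun j hj => ?_]
        · rw [Function.update_self]; ring
        · rw [Function.update_of_ne]
          simpa using hj
      have hfac : (∏ j, (((m j : ℕ).factorial : ℕ) : F)) =
          (m i : ℕ) * ∏ j, (((Function.update m i y j : ℕ).factorial : ℕ) : F) := by
        rw [Fintype.prod_eq_mul_prod_compl i,
          Fintype.prod_eq_mul_prod_compl i (fun j => (((Function.update m i y j : ℕ).factorial : ℕ) : F)),
          ← hy, Finset.prod_congr rfl fun j hj => ?_]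
        · rw [Function.update_self, Nat.factorial_succ]
          push_cast
          ring
        · rw [Function.update_of_ne]
          simpa using hj
      have hm : ((m i : ℕ) : F) ≠ 0 := by
        rw [Ne, CharP.cast_eq_zero_iff F p]
        exact fun h => h0 (Nat.eq_zero_of_dvd_of_lt h (m i).2)
      rw [hfac, hcode, Nat.add_sub_cancel, mul_inv]
      field_simp
    · intro z _ hz
      rw [shift, if_neg, zero_mul]
      exact fun h => hz (Fin.ext (by omega))
    · simp

variable (F p f) in
/-- Linear combinations of divided monomials. -/
noncomputable def monomialSum : ((Fin f → Fin p) → F) →ₗ[F] (F → F) :=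
  Fintype.linearCombination F (dividedMonomial F)

omit [Fintype F] [Fact p.Prime] in
lemma monomialSum_apply (c : (Fin f → Fin p) → F) :
    monomialSum F p f c = ∑ m, c m • dividedMonomial F m := rfl

lemma monomialSum_injective [CharP F p] (hF : Fintype.card F = p ^ f) :
    Function.Injective (monomialSum F p f) := by
  classical
  rw [← LinearMap.ker_eq_bot, LinearMap.ker_eq_bot']
  intro c hc
  -- A polynomial of degree less than q vanishing on all of `F` is zero, and different digit vectors
  -- give different exponents.
  let P : Polynomial F := ∑ m, Polynomial.monomial (finFunctionFinEquiv m : ℕ)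
    (c m * (∏ j, (((m j : ℕ).factorial : ℕ) : F))⁻¹)
  have hP : P = 0 := by
    refine Polynomial.eq_zero_of_natDegree_lt_card_of_eval_eq_zero P Function.injective_id
      (fun x => ?_) ?_
    · have := congrFun hc x
      rw [monomialSum_apply, Finset.sum_apply] at this
      simpa [P, Polynomial.eval_finsetSum, dividedMonomial, mul_assoc] using this
    · rw [hF]
      refine lt_of_le_of_lt (Polynomial.natDegree_sum_le_of_forall_le (n := p ^ f - 1) _ _ fun m _ => ?_) ?_
      · refine (Polynomial.natDegree_monomial_le _).trans ?_
        have := (finFunctionFinEquiv m).2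
        omega
      · have := Nat.one_le_pow f p (Fact.out : p.Prime).pos
        omega
  funext m
  have h1 := congrArg (fun P => Polynomial.coeff P (finFunctionFinEquiv m : ℕ)) hP
  simp only [P, Polynomial.finsetSum_coeff, Polynomial.coeff_monomial, Polynomial.coeff_zero] at h1
  rw [Finset.sum_eq_single m] at h1
  · rw [if_pos rfl] at h1
    exact (mul_eq_zero.1 h1).resolve_right (inv_ne_zero (prod_factorial_ne_zero m))
  · intro n _ hn
    rw [if_neg]
    exact fun h => hn (finFunctionFinEquiv.injective (Fin.ext h))
  · simp

lemma hasse_monomialSum [CharP F p] (hF : Fintype.card F = p ^ f) (i : Fin f)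
    (c : (Fin f → Fin p) → F) : hasse F (p ^ (i : ℕ)) (monomialSum F p f c) =
      monomialSum F p f (coordOp i (shift F p) c) := by
  rw [monomialSum_apply, monomialSum_apply, map_sum]
  simp only [map_smul, hasse_dividedMonomial hF, coordOp_apply, Finset.sum_smul, Finset.smul_sum]
  rw [← Fintype.sum_prod_type', ← Fintype.sum_prod_type']
  let e : (Fin f → Fin p) × Fin p ≃ (Fin f → Fin p) × Fin p :=
    { toFun := fun x => (Function.update x.1 i x.2, x.1 i)
      invFun := fun x => (Function.update x.1 i x.2, x.1 i)
      left_inv := fun x => by simp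
      right_inv := fun x => by simp }
  refine Fintype.sum_equiv e _ _ fun x => ?_
  simp [e, smul_smul, mul_comm]

lemma sum_pow_card_sub_one : ∑ x : F, x ^ (Fintype.card F - 1) = -1 := by
  classical
  have := Fintype.one_lt_card (α := F)
  rw [sum_eq_sum_units _ (zero_pow (by omega))]
  simpa using FiniteField.sum_pow_units F (Fintype.card F - 1)

/-- In the basis of divided monomials, S_i is the transposed Jordan block on digit i. A function
killed by all S_i is a multiple of x^(q−1), whose sum over the field is −1, so the augmentation
detects it. -/
theorem exists_hasse_inverse [CharP F p] (hF : Fintype.card F = p ^ f) :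
    ∃ S : Fin f → Module.End F (F → F),
      (∀ i : Fin f, hasse F (p ^ (i : ℕ)) * S i + S i ^ (p - 1) * hasse F (p ^ (i : ℕ)) ^ (p - 1) = 1) ∧
      (∀ i : Fin f, hasse F (p ^ (i : ℕ)) ^ (p - 1) * S i ^ (p - 1) + S i * hasse F (p ^ (i : ℕ)) = 1) ∧
      (∀ i : Fin f, hasse F (p ^ (i : ℕ)) ^ p = 0) ∧ (∀ i, S i ^ p = 0) ∧
      (∀ i j : Fin f, Commute (hasse F (p ^ (i : ℕ))) (hasse F (p ^ (j : ℕ)))) ∧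
      (∀ i j, Commute (S i) (S j)) ∧
      (∀ i j : Fin f, i ≠ j → Commute (hasse F (p ^ (i : ℕ))) (S j)) ∧
      ∀ g, (∀ i, S i g = 0) → ∑ x, g x = 0 → g = 0 := by
  classical
  have hp : p.Prime := Fact.out
  have hinj := monomialSum_injective (F := F) hF
  let Γ : ((Fin f → Fin p) → F) ≃ₗ[F] (F → F) :=
    LinearEquiv.ofInjectiveOfFinrankEq _ hinj (by simp [hF])
  have hΓ : ∀ c, Γ c = monomialSum F p f c := fun c => rfl
  have hh : ∀ i : Fin f, hasse F (p ^ (i : ℕ)) = Γ.conjRingEquiv (coordOp i (shift F p)) := fun i => by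
    refine LinearMap.ext fun g => ?_
    obtain ⟨c, rfl⟩ := Γ.surjective g
    rw [hΓ, hasse_monomialSum hF]
    simp [← hΓ]
  refine ⟨fun i => Γ.conjRingEquiv (coordOp i (shift F p).transpose), fun i => ?_, fun i => ?_,
    fun i => ?_, fun i => ?_, fun i j => ?_, fun i j => ?_, fun i j hij => ?_, fun g hg hs => ?_⟩
  · simp only [hh, ← map_pow, ← map_mul, ← map_add, shift_mul_transpose hp.one_le, map_one]
  · simp only [hh, ← map_pow, ← map_mul, ← map_add, transpose_mul_shift hp.one_le, map_one]
  · rw [hh, ← map_pow, ← map_pow, shift_pow_self, map_zero, map_zero]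
  · rw [← map_pow, ← map_pow, ← Matrix.transpose_pow, shift_pow_self, Matrix.transpose_zero,
      map_zero, map_zero]
  · rw [hh, hh]
    rcases eq_or_ne i j with rfl | hij
    · exact Commute.refl _
    · exact (coordOp_commute hij _ _).map _
  · rcases eq_or_ne i j with rfl | hij
    · exact Commute.refl _
    · exact (coordOp_commute hij _ _).map _
  · rw [hh]
    exact (coordOp_commute hij _ _).map _
  · obtain ⟨c, rfl⟩ := Γ.surjective g
    have h1 : ∀ m : Fin f → Fin p, ∀ i, (m i : ℕ) + 1 < p → c m = 0 := fun m i hm => by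
      have h2 : coordOp i (shift F p).transpose c = 0 := by
        have := hg i
        simpa using this
      have h3 := congrFun h2 (Function.update m i ⟨m i + 1, hm⟩)
      rw [coordOp_apply, Finset.sum_eq_single (m i)] at h3
      · simpa [shift] using h3
      · intro x _ hx
        rw [Matrix.transpose_apply, shift, if_neg, zero_mul]
        rw [Function.update_self]
        exact fun h => hx (Fin.ext (by simpa using h))
      · simp
    let t : Fin f → Fin p := fun _ => ⟨p - 1, by have := hp.pos; omega⟩
    have ht : ∀ m, m ≠ t → c m = 0 := fun m hm => by
      by_contra h
      refine hm (funext fun i => Fin.ext ?_)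
      have := mt (h1 m i) h
      have := (m i).2
      change (m i : ℕ) = p - 1
      omega
    have hcode : (finFunctionFinEquiv t : ℕ) = Fintype.card F - 1 := by
      rw [finFunctionFinEquiv_apply, hF]
      change ∑ i : Fin f, (p - 1) * p ^ (i : ℕ) = _
      rw [← Finset.mul_sum, Fin.sum_univ_eq_sum_range (fun i => p ^ i) f]
      have h4 := Nat.geomSum_eq hp.two_le f
      rw [h4, Nat.mul_div_cancel' ]
      simpa using Nat.sub_dvd_pow_sub_pow p 1 f
    have hg' : Γ c = c t • dividedMonomial F t := by
      rw [hΓ, monomialSum_apply, Finset.sum_eq_single t (fun m _ hm => by rw [ht m hm, zero_smul])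
        (by simp)]
    rw [hg'] at hs ⊢
    simp only [Pi.smul_apply, smul_eq_mul, dividedMonomial, ← Finset.mul_sum, hcode,
      sum_pow_card_sub_one] at hs
    have := prod_factorial_ne_zero (F := F) t
    have h5 : c t = 0 := by
      by_contra h
      exact absurd hs (mul_ne_zero h (mul_ne_zero (inv_ne_zero this) (by simp)))
    rw [h5, zero_smul]

end FiniteField
end TruncatedKoszul

namespace GroupHomologyZ

/-! ### Syzygies of a resolution -/

section Resolution
variable {k G : Type} [CommRing k] [Group G]

/-- The factorization of a map through a kernel. -/
noncomputable def kerLift {A B C : Rep.{0} k G} (φ : A ⟶ B) (ψ : C ⟶ A)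
    (h : ∀ c, φ.hom (ψ.hom c) = 0) : C ⟶ kerRep φ := Rep.ofHom
  { toFun := fun c => ⟨ψ.hom c, h c⟩
    map_add' := fun x y => by ext; simp
    map_smul' := fun r x => by ext; simp
    isIntertwining' := fun g => by
      ext c
      exact Rep.hom_comm_apply ψ g c }

variable {P : ℕ → Rep.{0} k G} {A : Rep.{0} k G}

/-- The syzygies of a resolution. -/
noncomputable def syzygy (ε : P 0 ⟶ A) (d : ∀ n, P (n + 1) ⟶ P n) : ℕ → Rep.{0} k G
  | 0 => A
  | 1 => kerRep ε
  | n + 2 => kerRep (d n)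

/-- Homology can be computed from a resolution by modules with vanishing homology whose
differentials vanish on coinvariants. -/
theorem card_groupHomology_eq_of_resolution (ε : P 0 ⟶ A) (d : ∀ n, P (n + 1) ⟶ P n)
    (hε : Function.Surjective ε.hom) (h0 : ∀ x, ε.hom x = 0 ↔ ∃ y, (d 0).hom y = x)
    (hd : ∀ n x, (d n).hom x = 0 ↔ ∃ y, (d (n + 1)).hom y = x)
    (hP : ∀ n k, Subsingleton (groupHomology (P n) (k + 1)))
    (hmin : ∀ n y, Representation.Coinvariants.mk (P n).ρ ((d n).hom y) = 0) (n : ℕ) :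
    Nat.card (groupHomology A (n + 1)) = Nat.card (P (n + 1)).ρ.Coinvariants := by
  let ι : ∀ n, syzygy ε d (n + 1) ⟶ P n := fun
    | 0 => kerIncl ε
    | n + 1 => kerIncl (d n)
  let π : ∀ n, P n ⟶ syzygy ε d n := fun
    | 0 => ε
    | 1 => kerLift ε (d 0) fun c => (h0 _).2 ⟨c, rfl⟩
    | n + 2 => kerLift (d n) (d (n + 1)) fun c => (hd n _).2 ⟨c, rfl⟩
  have hex' : ∀ n x, (∃ y, (d n).hom y = x) ↔ ∃ a, (ι n).hom a = x := fun n x => by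
    cases n with
    | zero => exact (h0 x).symm.trans ⟨fun h => ⟨⟨x, h⟩, rfl⟩, fun ⟨a, ha⟩ => ha ▸ a.2⟩
    | succ n => exact (hd n x).symm.trans ⟨fun h => ⟨⟨x, h⟩, rfl⟩, fun ⟨a, ha⟩ => ha ▸ a.2⟩
  refine card_groupHomology_eq_of_minimal (syzygy ε d) P ι π (fun n => ?_) (fun n => ?_)
    (fun n b => ?_) hP (fun n x => ?_) n
  · cases n with
    | zero => exact Subtype.val_injective
    | succ n => exact Subtype.val_injective
  · match n with
    | 0 => exact hε
    | 1 =>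
      intro x
      obtain ⟨y, hy⟩ := (h0 x.1).1 x.2
      exact ⟨y, Subtype.ext hy⟩
    | n + 2 =>
      intro x
      obtain ⟨y, hy⟩ := (hd n x.1).1 x.2
      exact ⟨y, Subtype.ext hy⟩
  · rw [← hex']
    match n with
    | 0 => exact h0 b
    | 1 => exact Iff.trans Subtype.ext_iff (hd 0 b)
    | n + 2 => exact Iff.trans Subtype.ext_iff (hd (n + 1) b)
  · obtain ⟨y, hy⟩ := (hex' n _).2 ⟨x, rfl⟩
    rw [← hy, hmin]

end Resolution

/-! ### Twisted function modules of the Borel subgroup -/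

section Borel
variable {F : Type} [Field F]

/-- The affine action of upper triangular matrices. -/
def affineAct (g : borel F) (x : F) : F := g.1 0 0 * (g.1 0 0 * x + g.1 0 1)

lemma borel_diag_mul (g : borel F) : g.1 0 0 * g.1 1 1 = 1 := by
  have h1 := SL2.det_eq g.1
  rw [mem_borel.1 g.2] at h1
  simpa using h1

lemma borel_mul_entry (g h : borel F) : (g * h).1 0 0 = g.1 0 0 * h.1 0 0 := by
  rw [Subgroup.coe_mul, SL2.mul_entry, mem_borel.1 h.2]
  ring

lemma affineAct_one (x : F) : affineAct 1 x = x := by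
  simp [affineAct]

lemma affineAct_mul (g h : borel F) (x : F) :
    affineAct (g * h) x = affineAct g (affineAct h x) := by
  simp only [affineAct, borel_mul_entry]
  rw [Subgroup.coe_mul, SL2.mul_entry]
  linear_combination (g.1 0 0 * g.1 0 1) * borel_diag_mul h

lemma borel_entry_ne_zero (g : borel F) : g.1 0 0 ≠ 0 := fun h => by
  simpa [h] using borel_diag_mul g

lemma borel_inv_entry (g : borel F) : (g⁻¹).1 0 0 = (g.1 0 0)⁻¹ := by
  rw [Subgroup.coe_inv, (SL2.inv_entries g.1).1]
  exact eq_inv_of_mul_eq_one_right (borel_diag_mul g)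

lemma affineAct_add (g : borel F) (x c : F) :
    affineAct g (x + c) = affineAct g x + g.1 0 0 ^ 2 * c := by
  simp only [affineAct]
  ring

/-- The permutation of the line defined by an upper triangular matrix. -/
def affinePerm (g : borel F) : Equiv.Perm F where
  toFun := affineAct g
  invFun := affineAct g⁻¹
  left_inv x := by rw [← affineAct_mul, inv_mul_cancel, affineAct_one]
  right_inv x := by rw [← affineAct_mul, mul_inv_cancel, affineAct_one]

/-- Functions on the line, twisted by powers of the diagonal character. -/
def weightRepresentation {I : Type} (e : I → ℕ) : Representation ℤ (borel F) (I → F → F) where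
  toFun g :=
    { toFun := fun φ α x => g.1 0 0 ^ e α * φ α (affineAct g⁻¹ x)
      map_add' := fun φ ψ => by ext; simp [mul_add]
      map_smul' := fun r φ => by ext; simp; ring }
  map_one' := by
    refine LinearMap.ext fun φ => funext fun α => funext fun x => ?_
    simp [affineAct_one]
  map_mul' g h := by
    refine LinearMap.ext fun φ => funext fun α => funext fun x => ?_
    change (g * h).1 0 0 ^ e α * φ α (affineAct (g * h)⁻¹ x) =
      g.1 0 0 ^ e α * (h.1 0 0 ^ e α * φ α (affineAct h⁻¹ (affineAct g⁻¹ x)))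
    rw [borel_mul_entry, mul_inv_rev, affineAct_mul, mul_pow, mul_assoc]

/-- `weightRepresentation` as an object of the category of representations. -/
noncomputable abbrev weightRep {I : Type} (e : I → ℕ) : Rep.{0} ℤ (borel F) :=
  Rep.of (weightRepresentation e)

variable {I : Type} (e : I → ℕ)

lemma weightRepresentation_apply (g : borel F) (φ : I → F → F) (α : I) (x : F) :
    weightRepresentation e g φ α x = g.1 0 0 ^ e α * φ α (affineAct g⁻¹ x) := rfl

/-- The element of the Borel subgroup with given first row. -/
def borelMk (t : Fˣ) (b : F) : borel F :=
  ⟨SL2.mk t b 0 (t⁻¹ : Fˣ) (by simp), by simp [mem_borel]⟩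

lemma affineAct_borelMk (t : Fˣ) (b x : F) : affineAct (borelMk t b) x = t * (t * x + b) := by
  simp [affineAct, borelMk]

lemma borelMk_surjective (g : borel F) : ∃ t b, borelMk t b = g := by
  refine ⟨Units.mk0 _ (borel_entry_ne_zero g), g.1 0 1, Subtype.ext ?_⟩
  have h1 := borel_diag_mul g
  rw [SL2.ext_iff']
  simp only [borelMk, SL2.mk_entries, Units.val_mk0, mem_borel.1 g.2, Units.val_inv_eq_inv_val,
    true_and]
  exact inv_eq_of_mul_eq_one_right h1

/-- The first row determines an element of the Borel subgroup. -/
noncomputable def borelRow : Fˣ × F ≃ borel F :=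
  Equiv.ofBijective (fun x => borelMk x.1 x.2) ⟨fun x y h => by
    have h1 : (borelMk x.1 x.2).1 = (borelMk y.1 y.2).1 := congrArg _ h
    rw [SL2.ext_iff'] at h1
    simp only [borelMk, SL2.mk_entries] at h1
    exact Prod.ext (Units.ext h1.1) h1.2.1, fun g => by
    obtain ⟨t, b, h⟩ := borelMk_surjective g
    exact ⟨(t, b), h⟩⟩

variable [Fintype F]

/-- Take `θ` to be φ ↦ −φ(0) δ₀. For each x exactly q − 1 elements of the Borel subgroup move x to
0, one for each diagonal entry, and −(q − 1) = 1 in `F`. -/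
lemma subsingleton_weightRep (n : ℕ) :
    Subsingleton (groupHomology (weightRep (F := F) e) (n + 1)) := by
  classical
  have : Fintype (borel F) := Fintype.ofFinite _
  let θ : (I → F → F) →ₗ[ℤ] (I → F → F) :=
    { toFun := fun φ α x => if x = 0 then - φ α 0 else 0
      map_add' := fun φ ψ => by
        ext α x
        by_cases h : x = 0 <;> simp [h, add_comm]
      map_smul' := fun r φ => by
        ext α x
        by_cases h : x = 0 <;> simp [h] }
  refine subsingleton_of_sum (G := borel F) (weightRep e) θ (fun φ => ?_) n
  change φ = ∑ g : borel F, weightRepresentation e g⁻¹ (θ (weightRepresentation e g φ))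
  refine funext fun α => funext fun x => ?_
  have h1 : ∀ g : borel F, weightRepresentation e g⁻¹ (θ (weightRepresentation e g φ)) α x =
      if affineAct g x = 0 then - φ α x else 0 := fun g => by
    rw [weightRepresentation_apply, inv_inv]
    change _ * (if affineAct g x = 0 then
      - (g.1 0 0 ^ e α * φ α (affineAct g⁻¹ 0)) else 0) = _
    split_ifs with h
    · rw [← h, ← affineAct_mul, inv_mul_cancel, affineAct_one, borel_inv_entry]
      rw [mul_neg, ← mul_assoc, ← mul_pow, inv_mul_cancel₀ (borel_entry_ne_zero g), one_pow, one_mul]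
    · rw [mul_zero]
  rw [Finset.sum_apply, Finset.sum_apply, Finset.sum_congr rfl fun g _ => h1 g,
    ← borelRow.sum_comp, Fintype.sum_prod_type]
  have h3 : ∀ t : Fˣ, ∀ b : F, affineAct (borelRow (t, b)) x = 0 ↔ b = - (t * x) := fun t b => by
    change affineAct (borelMk t b) x = 0 ↔ _
    rw [affineAct_borelMk, mul_eq_zero, or_iff_right t.ne_zero, add_comm, add_eq_zero_iff_eq_neg]
  simp only [h3, Finset.sum_ite_eq', Finset.mem_univ, if_true, Finset.sum_const, Finset.card_univ,
    Fintype.card_units, nsmul_eq_mul]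
  rw [Nat.cast_sub Fintype.card_pos, FiniteField.cast_card_eq_zero]
  simp

section Coinvariants
variable [Fintype I] [DecidableEq I] [DecidableEq F]
open Representation.Coinvariants

omit [Fintype F] [Fintype I] in
lemma weightRepresentation_single (g : borel F) (α : I) (x c : F) :
    (weightRepresentation e) g (Pi.single α (Pi.single x c)) =
      Pi.single (M := fun _ => F → F) α (Pi.single (affineAct g x) (g.1 0 0 ^ e α * c)) := by
  refine funext fun β => funext fun y => (weightRepresentation_apply e g _ β y).trans ?_
  have h1 : affineAct g⁻¹ y = x ↔ y = affineAct g x := (affinePerm g).symm_apply_eq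
  by_cases hβ : β = α
  · subst hβ
    simp only [Pi.single_eq_same, Pi.single_apply, h1]
    split_ifs <;> simp
  · simp [hβ]

lemma mk_weightRep (φ : I → F → F) : mk (weightRepresentation e) φ =
    ∑ α, mk (weightRepresentation e) (Pi.single (M := fun _ => F → F) α (Pi.single 0 (∑ x, φ α x))) := by
  have h1 : φ = ∑ α, ∑ x, Pi.single (M := fun _ => F → F) α (Pi.single x (φ α x)) := by
    funext α
    rw [Finset.sum_apply, Finset.sum_eq_single α]
    · rw [Finset.sum_apply]
      simp only [Pi.single_eq_same]
      exact (Finset.univ_sum_single _).symm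
    · intro β _ hβ
      rw [Finset.sum_apply]
      exact Finset.sum_eq_zero fun x _ => Pi.single_eq_of_ne hβ.symm _
    · simp
  have h2 : ∀ α x c, mk (weightRepresentation e) (Pi.single (M := fun _ => F → F) α (Pi.single x c)) =
      mk (weightRepresentation e) (Pi.single (M := fun _ => F → F) α (Pi.single 0 c)) := fun α x c => by
    have h3 := mk_self_apply (weightRepresentation e) (borelMk 1 x)
      (Pi.single (M := fun _ => F → F) α (Pi.single 0 c))
    rw [weightRepresentation_single, affineAct_borelMk] at h3
    simpa [borelMk] using h3
  conv_lhs => rw [h1]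
  refine (map_sum (mk (weightRepresentation e)) _ _).trans (Finset.sum_congr rfl fun α _ => ?_)
  refine (map_sum (mk (weightRepresentation e)) _ _).trans ?_
  simp only [h2]
  let ψ : F →+ (weightRepresentation (F := F) e).Coinvariants :=
    (mk (weightRepresentation e)).toAddMonoidHom.comp
      ((AddMonoidHom.single (fun _ => F → F) α).comp (AddMonoidHom.single (fun _ => F) 0))
  exact (map_sum ψ (φ α) Finset.univ).symm

/-- Translations identify all delta functions of a component with those at 0. There the torus scales
by t^(e α), so a copy of `F` survives exactly when this character is trivial, that is when q − 1 ∣ e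
α. -/
lemma card_coinvariants_weightRep :
    Nat.card (weightRepresentation (F := F) e).Coinvariants =
      Fintype.card F ^ Nat.card {α // Fintype.card F - 1 ∣ e α} := by
  let s : (I → F → F) →ₗ[ℤ] ({α // Fintype.card F - 1 ∣ e α} → F) :=
    { toFun := fun φ α => ∑ x, φ α x
      map_add' := fun φ ψ => by ext; simp [Finset.sum_add_distrib]
      map_smul' := fun r φ => by ext; simp [Finset.mul_sum] }
  let σ : (weightRepresentation (F := F) e).Coinvariants →ₗ[ℤ] ({α // Fintype.card F - 1 ∣ e α} → F) :=
    lift (weightRepresentation e) s fun g => by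
      refine LinearMap.ext fun φ => funext fun α => ?_
      change ∑ x, g.1 0 0 ^ e α * φ α (affineAct g⁻¹ x) =
        ∑ x, φ α x
      have h1 : g.1 0 0 ^ e α = 1 := by
        have := (FiniteField.forall_pow_eq_one_iff F _).2 α.2 (Units.mk0 _ (borel_entry_ne_zero g))
        simpa [Units.ext_iff] using this
      simp only [h1, one_mul]
      exact Equiv.sum_comp (affinePerm g⁻¹) (φ α)
  have hσ : ∀ φ, σ (mk _ φ) = s φ := fun φ => rfl
  have hinj : Function.Injective σ := by
    rw [injective_iff_map_eq_zero]
    intro y hy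
    induction y using Representation.Coinvariants.induction_on with | _ φ
    rw [hσ] at hy
    refine (mk_weightRep e φ).trans (Finset.sum_eq_zero fun α _ => ?_)
    by_cases hα : Fintype.card F - 1 ∣ e α
    · have h1 : ∑ x, φ α x = 0 := congrFun hy ⟨α, hα⟩
      exact (congrArg (fun c => mk (weightRepresentation e)
        (Pi.single (M := fun _ => F → F) α (Pi.single 0 c))) h1).trans (by simp)
    · rw [← FiniteField.forall_pow_eq_one_iff] at hα
      push Not at hα
      obtain ⟨t, ht⟩ := hα
      have ht' : (t : F) ^ e α - 1 ≠ 0 := fun h => ht (Units.ext (by simpa using sub_eq_zero.1 h))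
      generalize (∑ x, φ α x) = c
      obtain ⟨c, rfl⟩ : ∃ c', c = ((t : F) ^ e α - 1) * c' :=
        ⟨((t : F) ^ e α - 1)⁻¹ * c, by field_simp⟩
      have h3 := mk_self_apply (weightRepresentation e) (borelMk t 0)
        (Pi.single (M := fun _ => F → F) α (Pi.single 0 c))
      rw [weightRepresentation_single, affineAct_borelMk] at h3
      have h4 : Pi.single (M := fun _ => F → F) α (Pi.single 0 (((t : F) ^ e α - 1) * c)) =
        Pi.single (M := fun _ => F → F) α (Pi.single 0 ((t : F) ^ e α * c)) -
          Pi.single (M := fun _ => F → F) α (Pi.single 0 c) := by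
        rw [← Pi.single_sub, ← Pi.single_sub, sub_mul, one_mul]
      rw [h4]
      refine (map_sub (mk (weightRepresentation e)) _ _).trans (sub_eq_zero.2 ?_)
      simpa [borelMk] using h3
  have hsurj : Function.Surjective σ := fun c => by
    refine ⟨mk _ (fun α => if h : Fintype.card F - 1 ∣ e α then Pi.single 0 (c ⟨α, h⟩) else 0), ?_⟩
    rw [hσ]
    funext α
    change ∑ x, (if h : Fintype.card F - 1 ∣ e α then (Pi.single 0 (c ⟨α, h⟩) : F → F) else 0) x = _
    rw [dif_pos α.2]
    simp
  rw [Nat.card_congr (Equiv.ofBijective σ ⟨hinj, hsurj⟩), Nat.card_fun, Nat.card_eq_fintype_card]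

end Coinvariants
end Borel
open TruncatedKoszul

/-! ### The truncated Koszul resolution over the Borel subgroup -/

section Weights
variable {f : ℕ} (p : ℕ)

/-- The partial sums of the exponents `1, p - 1, 1, p - 1, …`. -/
def halfWeight (b : ℕ) : ℕ := b / 2 * p + b % 2

/-- The weight of a multidegree of the truncated Koszul resolution. -/
def weight (α : Fin f → ℕ) : ℕ := 2 * ∑ i : Fin f, p ^ (i : ℕ) * halfWeight p (α i)

variable {p}

lemma halfWeight_succ (hp : 1 ≤ p) (b : ℕ) :
    halfWeight p (b + 1) = halfWeight p b + step p b := by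
  rcases Nat.even_or_odd' b with ⟨c, rfl | rfl⟩
  · rw [halfWeight, halfWeight, step, if_pos (even_two_mul c), show (2 * c + 1) / 2 = c by omega,
      show (2 * c + 1) % 2 = 1 by omega, show 2 * c / 2 = c by omega, show 2 * c % 2 = 0 by omega]
  · rw [halfWeight, halfWeight, step, if_neg (Nat.not_even_iff_odd.2 (odd_two_mul_add_one c)),
      show (2 * c + 1) / 2 = c by omega, show (2 * c + 1) % 2 = 1 by omega,
      show (2 * c + 1 + 1) / 2 = c + 1 by omega, show (2 * c + 1 + 1) % 2 = 0 by omega, add_mul]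
    omega

lemma weight_add_single (hp : 1 ≤ p) (α : Fin f → ℕ) (i : Fin f) :
    weight p (α + Pi.single i 1) = weight p α + 2 * p ^ (i : ℕ) * step p (α i) := by
  have h1 : ∀ j : Fin f, p ^ (j : ℕ) * halfWeight p ((α + Pi.single i 1 : Fin f → ℕ) j) =
      p ^ (j : ℕ) * halfWeight p (α j) + if j = i then p ^ (i : ℕ) * step p (α i) else 0 := fun j => by
    by_cases h : j = i
    · subst h
      simp [halfWeight_succ hp, mul_add]
    · simp [h]
  simp only [weight, h1, Finset.sum_add_distrib, Finset.sum_ite_eq', Finset.mem_univ, if_true]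
  ring

end Weights

section Koszul
variable {F : Type} [Field F] [Fintype F]

/-- The diagonal entry t scales increments by t², so substituting t⁻² c for c in the defining sum
costs the factor t^(2l). This dictates the weights that make the differential equivariant. -/
lemma hasse_affine (g : borel F) (l : ℕ) (u : F → F) :
    g.1 0 0 ^ (2 * l) • hasse F l (u ∘ affineAct g⁻¹) = hasse F l u ∘ affineAct g⁻¹ := by
  funext x
  rw [Pi.smul_apply, Function.comp_apply, hasse_apply, hasse_apply, smul_neg, Finset.smul_sum]
  congr 1
  refine Fintype.sum_equiv (Equiv.mulLeft₀ (((g⁻¹).1 0 0) ^ 2)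
    (pow_ne_zero _ (borel_entry_ne_zero g⁻¹))) _ _ fun c => ?_
  change g.1 0 0 ^ (2 * l) * (c⁻¹ ^ l * (u (affineAct g⁻¹ (x + c)) - u (affineAct g⁻¹ x))) =
    ((g⁻¹).1 0 0 ^ 2 * c)⁻¹ ^ l * (u (affineAct g⁻¹ x + (g⁻¹).1 0 0 ^ 2 * c) - u (affineAct g⁻¹ x))
  rw [affineAct_add, borel_inv_entry, mul_inv, inv_pow _ 2, inv_inv, mul_pow, ← pow_mul, mul_assoc]

lemma hasse_pow_affine (g : borel F) (l s : ℕ) (u : F → F) :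
    g.1 0 0 ^ (2 * l * s) • (hasse F l ^ s) (u ∘ affineAct g⁻¹) =
      (hasse F l ^ s) u ∘ affineAct g⁻¹ := by
  induction s with
  | zero => simp
  | succ s ih =>
    rw [pow_succ', Module.End.mul_apply, Module.End.mul_apply, mul_add, mul_one, add_comm, pow_add,
      mul_smul, ← map_smul, ih, hasse_affine]

/-- Multidegrees of fixed total degree. -/
abbrev Multidegree (f n : ℕ) := {α : Fin f → ℕ // ∑ i, α i = n}

lemma sum_add_single {f n : ℕ} {α : Fin f → ℕ} (i : Fin f) :
    ∑ j, (α + Pi.single i 1 : Fin f → ℕ) j = n + 1 ↔ ∑ j, α j = n := by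
  simp [Finset.sum_add_distrib]

/-- Raising one entry of a multidegree. -/
def Multidegree.succ {f n : ℕ} (α : Multidegree f n) (i : Fin f) : Multidegree f (n + 1) :=
  ⟨α.1 + Pi.single i 1, (sum_add_single i).2 α.2⟩

variable {p f : ℕ}

variable (F p f) in
/-- The terms of the truncated Koszul resolution. -/
noncomputable abbrev koszulRep (n : ℕ) : Rep.{0} ℤ (borel F) :=
  weightRep fun α : Multidegree f n => weight p α.1

variable (F p f) in
/-- The differential of the truncated Koszul resolution, as a linear map. -/
def koszulDiff (n : ℕ) : (Multidegree f (n + 1) → F → F) →ₗ[F] (Multidegree f n → F → F) where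
  toFun ψ α := ∑ i, sign F i α.1 • (hasse F (p ^ (i : ℕ)) ^ step p (α.1 i)) (ψ (α.succ i))
  map_add' ψ ψ' := by ext; simp [Finset.sum_add_distrib]
  map_smul' r ψ := by
    funext α
    simp only [Pi.smul_apply, map_smul, RingHom.id_apply, Finset.smul_sum]
    exact Finset.sum_congr rfl fun i _ => smul_comm _ _ _

section Differential
variable [Fact p.Prime]

variable (F p f) in
/-- The differential of the truncated Koszul resolution. -/
noncomputable def koszulMap (n : ℕ) : koszulRep F p f (n + 1) ⟶ koszulRep F p f n := Rep.ofHom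
  { toFun := koszulDiff F p f n
    map_add' := map_add _
    map_smul' := fun r x => map_zsmul _ r x
    isIntertwining' := fun g => by
      refine LinearMap.ext fun ψ => funext fun α => funext fun x => ?_
      change (∑ i, sign F i α.1 • (hasse F (p ^ (i : ℕ)) ^ step p (α.1 i))
        (g.1 0 0 ^ weight p (α.1 + Pi.single i 1) • (ψ (α.succ i) ∘ affineAct g⁻¹))) x =
        g.1 0 0 ^ weight p α.1 * (∑ i, sign F i α.1 • (hasse F (p ^ (i : ℕ)) ^ step p (α.1 i))
          (ψ (α.succ i))) (affineAct g⁻¹ x)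
      rw [Finset.sum_apply, Finset.sum_apply, Finset.mul_sum]
      refine Finset.sum_congr rfl fun i _ => ?_
      rw [weight_add_single (Fact.out : p.Prime).one_le, pow_add, mul_smul, map_smul, map_smul,
        hasse_pow_affine]
      simp only [Pi.smul_apply, smul_eq_mul, Function.comp_apply]
      ring }

end Differential

variable (F p f) in
/-- The augmentation of the truncated Koszul resolution. -/
noncomputable def koszulAug : koszulRep F p f 0 ⟶ Rep.trivial ℤ (borel F) F := Rep.ofHom
  { toFun := fun φ => ∑ x, φ ⟨0, by simp⟩ x
    map_add' := fun φ ψ => by simp [Finset.sum_add_distrib]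
    map_smul' := fun r φ => by simp [Finset.mul_sum]
    isIntertwining' := fun g => by
      refine LinearMap.ext fun φ => ?_
      change ∑ x, g.1 0 0 ^ weight p (0 : Fin f → ℕ) * φ ⟨0, by simp⟩ (affineAct g⁻¹ x) =
        ∑ x, φ ⟨0, by simp⟩ x
      simp only [weight, halfWeight, Pi.zero_apply, Nat.zero_div, zero_mul, Nat.zero_mod, add_zero,
        mul_zero, Finset.sum_const_zero, pow_zero, one_mul]
      exact Equiv.sum_comp (affinePerm g⁻¹) (φ ⟨0, _⟩) }

/-- Extension by zero to all multidegrees. -/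
def extendZero (n : ℕ) (ψ : Multidegree f n → F → F) (α : Fin f → ℕ) : F → F :=
  if h : ∑ i, α i = n then ψ ⟨α, h⟩ else 0

omit [Fintype F] in
lemma extendZero_val (n : ℕ) (ψ : Multidegree f n → F → F) (α : Multidegree f n) :
    extendZero n ψ α.1 = ψ α := dif_pos α.2

variable (F p f) in
/-- The total differential on functions of all multidegrees. -/
abbrev totalDiff : Module.End F ((Fin f → ℕ) → F → F) :=
  ∑ i : Fin f, diff p (fun i : Fin f => hasse F (p ^ (i : ℕ))) i

lemma totalDiff_apply (φ : (Fin f → ℕ) → F → F) (β : Fin f → ℕ) :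
    totalDiff F p f φ β =
      ∑ i, sign F i β • (hasse F (p ^ (i : ℕ)) ^ step p (β i)) (φ (β + Pi.single i 1)) := by
  rw [LinearMap.sum_apply, Finset.sum_apply]
  rfl

lemma koszulDiff_restrict (n : ℕ) (φ : (Fin f → ℕ) → F → F) :
    koszulDiff F p f n (fun α => φ α.1) = fun α => totalDiff F p f φ α.1 := by
  funext α
  rw [totalDiff_apply]
  rfl

lemma totalDiff_extendZero (n : ℕ) (ψ : Multidegree f (n + 1) → F → F) :
    totalDiff F p f (extendZero (n + 1) ψ) = extendZero n (koszulDiff F p f n ψ) := by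
  funext β
  rw [totalDiff_apply]
  by_cases h : ∑ i, β i = n
  · rw [extendZero, dif_pos h]
    refine Finset.sum_congr rfl fun i _ => ?_
    rw [extendZero, dif_pos ((sum_add_single i).2 h)]
    rfl
  · rw [extendZero, dif_neg h]
    refine Finset.sum_eq_zero fun i _ => ?_
    rw [extendZero, dif_neg (mt (sum_add_single i).1 h), map_zero, smul_zero]

lemma sum_hasse_pow (l s : ℕ) (hs : s ≠ 0) (g : F → F) : ∑ x, (hasse F l ^ s) g x = 0 := by
  obtain ⟨s, rfl⟩ := Nat.exists_eq_succ_of_ne_zero hs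
  rw [Nat.succ_eq_add_one, pow_succ', Module.End.mul_apply, sum_hasse]

variable [Fact p.Prime]

lemma sum_koszulDiff (n : ℕ) (ψ : Multidegree f (n + 1) → F → F) (α : Multidegree f n) :
    ∑ x, koszulDiff F p f n ψ α x = 0 := by
  have hp := (Fact.out : p.Prime).two_le
  change ∑ x, (∑ i, sign F i α.1 • (hasse F (p ^ (i : ℕ)) ^ step p (α.1 i)) (ψ (α.succ i))) x = 0
  simp only [Finset.sum_apply, Pi.smul_apply]
  rw [Finset.sum_comm]
  refine Finset.sum_eq_zero fun i _ => ?_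
  rw [← Finset.smul_sum, sum_hasse_pow, smul_zero]
  rw [step]
  split_ifs <;> omega

variable [CharP F p]

/-- The obstruction to being a boundary lives in multidegree zero and is a multiple of x^(q−1);
having sum zero, it vanishes. -/
lemma exists_koszulDiff (hF : Fintype.card F = p ^ f) (n : ℕ) (φ : Multidegree f n → F → F)
    (h : totalDiff F p f (extendZero n φ) = 0) (h0 : ∀ α : Multidegree f n, α.1 = 0 → ∑ x, φ α x = 0) :
    ∃ ψ, koszulDiff F p f n ψ = φ := by
  obtain ⟨S, hDS, hSD, hD, hS, hd, hs, hc, h1⟩ := exists_hasse_inverse (p := p) hF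
  obtain ⟨ψ, χ, h2, h3, h4, h5⟩ := exists_eq_diff_add (Fact.out : p.Prime).one_le hDS hSD hD hS hd hs
    hc (extendZero n φ) h
  refine ⟨fun α => ψ α.1, ?_⟩
  rw [koszulDiff_restrict]
  funext α
  have h6 : totalDiff F p f ψ α.1 + χ α.1 = φ α := by
    rw [← extendZero_val n φ α, h2]
    rfl
  by_cases hα : α.1 = 0
  · have h7 : χ 0 = 0 := by
      refine h1 _ h5 ?_
      rw [← hα, eq_sub_of_add_eq' h6]
      simp only [Pi.sub_apply, Finset.sum_sub_distrib]
      have h8 := sum_koszulDiff (p := p) n (fun α => ψ α.1) α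
      rw [koszulDiff_restrict] at h8
      rw [h0 α hα, h8, sub_zero]
    rw [← h6, hα, h7, add_zero]
  · rw [← h6, h3 _ hα, add_zero]

lemma koszulDiff_koszulDiff (hF : Fintype.card F = p ^ f) (n : ℕ)
    (ψ : Multidegree f (n + 2) → F → F) :
    koszulDiff F p f n (koszulDiff F p f (n + 1) ψ) = 0 := by
  obtain ⟨S, hDS, hSD, hD, hS, hd, hs, hc, h1⟩ := exists_hasse_inverse (p := p) hF
  have h2 : ψ = fun α => extendZero (n + 2) ψ α.1 := funext fun α => (extendZero_val _ _ α).symm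
  rw [h2, koszulDiff_restrict, koszulDiff_restrict]
  have h3 := diff_diff (Fact.out : p.Prime).one_le hD hd
  funext α
  exact congrFun (LinearMap.congr_fun h3 (extendZero (n + 2) ψ)) α.1

instance (f n : ℕ) : Finite (Multidegree f n) :=
  Finite.of_injective (β := Fin f → Fin (n + 1)) (fun α i => ⟨α.1 i, Nat.lt_succ_of_le
    ((Finset.single_le_sum (fun j _ => Nat.zero_le (α.1 j)) (Finset.mem_univ i)).trans α.2.le)⟩)
    fun _ _ h => Subtype.ext (funext fun i => congrArg Fin.val (congrFun h i))

/-- The homology of the Borel subgroup with coefficients in the field. -/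
theorem card_groupHomology_borel (hF : Fintype.card F = p ^ f) (n : ℕ) :
    Nat.card (groupHomology (Rep.trivial ℤ (borel F) F) (n + 1)) = Fintype.card F ^
      Nat.card {α : Multidegree f (n + 1) // Fintype.card F - 1 ∣ weight p α.1} := by
  classical
  have hfin : ∀ n, Fintype (Multidegree f n) := fun n => Fintype.ofFinite _
  rw [card_groupHomology_eq_of_resolution (P := koszulRep F p f) (koszulAug F p f) (koszulMap F p f)
    (fun c => ⟨fun _ => Pi.single 0 c, ?_⟩) (fun φ => ⟨fun h => ?_, ?_⟩) (fun n φ => ⟨fun h => ?_, ?_⟩)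
    (fun n k => subsingleton_weightRep _ k) (fun n ψ => ?_) n, ← card_coinvariants_weightRep]
  · change ∑ x, (Pi.single 0 c : F → F) x = c
    simp
  · refine exists_koszulDiff hF 0 φ ?_ fun α hα => ?_
    · funext β
      rw [totalDiff_apply]
      refine Finset.sum_eq_zero fun i _ => ?_
      rw [extendZero, dif_neg, map_zero, smul_zero]
      simp [Finset.sum_add_distrib]
    · obtain rfl : α = ⟨0, by simp⟩ := Subtype.ext hα
      exact h
  · rintro ⟨ψ, rfl⟩
    exact sum_koszulDiff 0 ψ ⟨0, by simp⟩
  · refine exists_koszulDiff hF (n + 1) φ ?_ fun α hα => ?_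
    · rw [totalDiff_extendZero]
      replace h : koszulDiff F p f n φ = 0 := h
      rw [h]
      funext β
      exact dite_eq_right_iff.2 fun _ => rfl
    · have := α.2
      rw [hα] at this
      simp at this
  · rintro ⟨ψ, rfl⟩
    exact koszulDiff_koszulDiff hF n ψ
  -- Minimality: coinvariants see only the sums of the components, and these vanish on boundaries.
  · refine (mk_weightRep (F := F) _ (koszulDiff F p f n ψ)).trans (Finset.sum_eq_zero fun α _ => ?_)
    rw [sum_koszulDiff, Pi.single_zero, Pi.single_zero, map_zero]

end Koszul

/-! ### Divisibility of sums of prime powers by q − 1 -/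

section Arithmetic
variable {p f : ℕ}

lemma coprime_pow_sub_one (hp : p.Prime) (hf : f ≠ 0) : Nat.Coprime (p ^ f - 1) p := by
  refine Nat.Coprime.symm ((Nat.Prime.coprime_iff_not_dvd hp).2 fun h => ?_)
  have h1 := Nat.one_le_pow f p hp.pos
  have h2 : p ∣ p ^ f := dvd_pow_self p hf
  have h3 := (Nat.dvd_sub_iff_right h1 h2).1 h
  exact hp.one_lt.ne' (Nat.dvd_one.1 h3)

lemma pow_le_three_of_dvd (hp : p.Prime) (hf : f ≠ 0) (a : ℕ) (h : p ^ f - 1 ∣ 2 * p ^ a) :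
    p ^ f ≤ 3 := by
  have h1 := Nat.le_of_dvd two_pos
    (((coprime_pow_sub_one hp hf).pow_right a).dvd_of_dvd_mul_right h)
  omega

/-- Cancel the smaller power of p, which is prime to q − 1, and reduce the remaining exponent modulo
f using p^f ≡ 1. -/
lemma dvd_reduce (hp : p.Prime) (hf : f ≠ 0) (a b : ℕ) (h : p ^ f - 1 ∣ 2 * (p ^ a + p ^ b)) :
    ∃ r < f, p ^ f - 1 ∣ 2 * (1 + p ^ r) := by
  wlog hab : a ≤ b generalizing a b
  · exact this b a (by rwa [add_comm]) (by omega)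
  obtain ⟨d, rfl⟩ := Nat.exists_eq_add_of_le hab
  rw [show 2 * (p ^ a + p ^ (a + d)) = 2 * (1 + p ^ d) * p ^ a by ring] at h
  replace h := ((coprime_pow_sub_one hp hf).pow_right a).dvd_of_dvd_mul_right h
  refine ⟨d % f, Nat.mod_lt _ (Nat.pos_of_ne_zero hf), ?_⟩
  have h1 : p ^ f ≡ 1 [MOD p ^ f - 1] :=
    ((Nat.modEq_iff_dvd' (Nat.one_le_pow f p hp.pos)).2 dvd_rfl).symm
  have h2 : p ^ d ≡ p ^ (d % f) [MOD p ^ f - 1] := by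
    conv_lhs => rw [← Nat.div_add_mod d f, pow_add, pow_mul]
    simpa using (h1.pow (d / f)).mul_right (p ^ (d % f))
  exact (Nat.modEq_zero_iff_dvd.1 ((((h2.add_left 1).mul_left 2).symm).trans
    (Nat.modEq_zero_iff_dvd.2 h)))

/-- With x = p^r and y = p^(f−r), multiplying by y turns the divisibility for x into the one for y.
Hence xy ≤ 2x + 3 and xy ≤ 2y + 3, whose only solution with xy > 6 is x = y = 3. -/
lemma pow_le_six_of_dvd (hp : p.Prime) (hf : f ≠ 0) (a b : ℕ)
    (h : p ^ f - 1 ∣ 2 * (p ^ a + p ^ b)) : p ^ f ≤ 6 ∨ p ^ f = 9 := by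
  obtain ⟨r, hr, h1⟩ := dvd_reduce hp hf a b h
  have h2 : p ^ f - 1 ∣ 2 * (1 + p ^ (f - r)) := by
    have h3 : 2 * (1 + p ^ r) * p ^ (f - r) = 2 * (1 + p ^ (f - r)) + 2 * (p ^ f - 1) := by
      have h4 : p ^ r * p ^ (f - r) = p ^ f := by rw [← pow_add]; congr 1; omega
      have h5 := Nat.one_le_pow f p hp.pos
      calc 2 * (1 + p ^ r) * p ^ (f - r) = 2 * (p ^ (f - r) + p ^ r * p ^ (f - r)) := by ring
        _ = _ := by rw [h4]; omega
    exact (Nat.dvd_add_left (Dvd.intro_left 2 rfl)).1 (h3 ▸ h1.mul_right _)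
  have h4 : p ^ r * p ^ (f - r) = p ^ f := by rw [← pow_add]; congr 1; omega
  have h5 := Nat.le_of_dvd (by positivity) h1
  have h6 := Nat.le_of_dvd (by positivity) h2
  have h7 := Nat.one_le_pow r p hp.pos
  rw [← h4] at h5 h6 ⊢
  generalize p ^ r = x at *
  generalize p ^ (f - r) = y at *
  have hx : x ≤ 5 ∨ y ≤ 2 := by
    by_contra! hc
    have := Nat.mul_le_mul_left x (show 3 ≤ y by omega)
    omega
  have hy : y ≤ 5 ∨ x ≤ 2 := by
    by_contra! hc
    have := Nat.mul_le_mul_right y (show 3 ≤ x by omega)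
    omega
  rcases hx with hx | hx
  · interval_cases x <;> omega
  · interval_cases y <;> omega

/-- With f = e + 3 the three powers are at most p^e, p^(e+1), p^(e+2), and size alone decides. For p
= 2 the factor 2 is dropped first, as q − 1 is odd. -/
lemma pow_eq_of_dvd (hp : p.Prime) {a b c : ℕ} (hab : a < b) (hbc : b < c) (hc : c < f)
    (h : p ^ f - 1 ∣ 2 * (p ^ a + p ^ b + p ^ c)) : p ^ f = 8 ∨ p ^ f = 27 := by
  obtain ⟨e, rfl⟩ := Nat.exists_eq_add_of_le' (show 3 ≤ f by omega)
  have ha := Nat.pow_le_pow_right hp.pos (show a ≤ e by omega)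
  have hb := Nat.pow_le_pow_right hp.pos (show b ≤ e + 1 by omega)
  have hc' := Nat.pow_le_pow_right hp.pos (show c ≤ e + 2 by omega)
  have hpos := Nat.one_le_pow e p hp.pos
  have hapos : 0 < p ^ a := Nat.pow_pos hp.pos
  by_cases h2 : p = 2
  · subst h2
    have hcop : Nat.Coprime (2 ^ (e + 3) - 1) 2 := coprime_pow_sub_one hp (by omega)
    have h3 := Nat.le_of_dvd (by positivity) (hcop.dvd_of_dvd_mul_left h)
    have h4 : 2 ^ (e + 3) = 8 * 2 ^ e := by ring
    have h5 : 2 ^ (e + 2) = 4 * 2 ^ e := by ring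
    have h6 : 2 ^ (e + 1) = 2 * 2 ^ e := by ring
    omega
  · have h1 := Nat.le_of_dvd (by positivity) h
    have hp3 : 3 ≤ p := by have := hp.two_le; omega
    obtain ⟨t, rfl⟩ := Nat.exists_eq_add_of_le hp3
    set x := (3 + t) ^ e with hx
    have h4 : (3 + t) ^ (e + 3) = x * (3 + t) ^ 3 := by rw [hx]; ring
    have h5 : (3 + t) ^ (e + 2) = x * (3 + t) ^ 2 := by rw [hx]; ring
    have h6 : (3 + t) ^ (e + 1) = x * (3 + t) := by rw [hx]; ring
    rw [h4] at h1 ⊢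
    rw [h5] at hc'
    rw [h6] at hb
    have h7 : x * (3 + t) ^ 3 ≤ 2 * (x + x * (3 + t) + x * (3 + t) ^ 2) + 1 := by omega
    -- The cubic is P³ − 2(1 + P + P²) at P = 3 + t.
    have h8 : x * (1 + 13 * t + 7 * t ^ 2 + t ^ 3) ≤ 1 := by nlinarith
    have h9 : x = 1 := by nlinarith [Nat.zero_le (x * (13 * t + 7 * t ^ 2 + t ^ 3))]
    have h10 : t = 0 := by
      rw [h9] at h8
      nlinarith
    subst h10
    right
    rw [h9]
    norm_num

end Arithmetic

/-! ### Counting multidegrees of trivial weight -/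

section Weights
variable {p f : ℕ}

lemma exists_eq_single_add {n : ℕ} {α : Fin f → ℕ} (h : ∑ i, α i = n + 1) :
    ∃ (β : Fin f → ℕ) (i : Fin f), ∑ j, β j = n ∧ α = β + Pi.single i 1 := by
  obtain ⟨i, -, hi⟩ := Finset.exists_ne_zero_of_sum_ne_zero (h.trans_ne n.succ_ne_zero)
  obtain ⟨β, rfl⟩ := exists_eq_add_single i α hi
  exact ⟨β, i, (sum_add_single i).1 h, rfl⟩

lemma eq_single_of_sum_eq_one {α : Fin f → ℕ} (h : ∑ i, α i = 1) : ∃ i, α = Pi.single i 1 := by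
  obtain ⟨β, i, hβ, rfl⟩ := exists_eq_single_add h
  refine ⟨i, ?_⟩
  have : β = 0 := funext fun j => (Finset.sum_eq_zero_iff.1 hβ) j (Finset.mem_univ j)
  rw [this, zero_add]

lemma weight_single (hp : 1 ≤ p) (i : Fin f) : weight p (Pi.single i 1) = 2 * p ^ (i : ℕ) := by
  have := weight_add_single hp 0 i
  rw [zero_add] at this
  simpa [weight, halfWeight, step] using this

lemma pow_add_pow_mul (hp : 1 ≤ p) (i : ℕ) : 2 * p ^ i + 2 * p ^ i * (p - 1) = 2 * p ^ (i + 1) := by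
  obtain ⟨p, rfl⟩ := Nat.exists_eq_add_of_le' hp
  rw [Nat.add_sub_cancel]
  ring

lemma weight_single_add_single (hp : 1 ≤ p) (i j : Fin f) :
    weight p (Pi.single i 1 + Pi.single j 1) =
      if i = j then 2 * p ^ (i + 1 : ℕ) else 2 * (p ^ (i : ℕ) + p ^ (j : ℕ)) := by
  rw [weight_add_single hp, weight_single hp]
  split_ifs with h
  · subst h
    rw [Pi.single_eq_same, step, if_neg (by decide), pow_add_pow_mul hp]
  · rw [Pi.single_eq_of_ne (Ne.symm h), step, if_pos (by decide)]
    ring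

/-- A repeated index merges two contributions, p^i + (p − 1) p^i = p^(i+1), leaving two powers of p;
otherwise the three indices are distinct and can be sorted. -/
lemma exists_weight_eq_of_sum_eq_three (hp : 1 ≤ p) {α : Fin f → ℕ} (h : ∑ i, α i = 3) :
    (∃ a b, weight p α = 2 * (p ^ a + p ^ b)) ∨
      ∃ a b c, a < b ∧ b < c ∧ c < f ∧ weight p α = 2 * (p ^ a + p ^ b + p ^ c) := by
  obtain ⟨β, k, hβ, rfl⟩ := exists_eq_single_add h
  obtain ⟨γ, j, hγ, rfl⟩ := exists_eq_single_add hβ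
  obtain ⟨i, rfl⟩ := eq_single_of_sum_eq_one hγ
  rw [weight_add_single hp, weight_single_add_single hp]
  by_cases hij : i = j
  · subst hij
    rw [if_pos rfl]
    left
    refine ⟨i + 1, k, ?_⟩
    have h1 : step p ((Pi.single i 1 + Pi.single i 1 : Fin f → ℕ) k) = 1 := by
      by_cases hk : k = i
      · subst hk; simp [step]
      · simp [step, hk]
    rw [h1]
    ring
  · rw [if_neg hij]
    by_cases hki : k = i
    · subst hki
      left
      refine ⟨j, k + 1, ?_⟩
      have h1 : step p ((Pi.single k 1 + Pi.single j 1 : Fin f → ℕ) k) = p - 1 := by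
        simp [step, hij]
      rw [h1]
      linarith [pow_add_pow_mul hp k]
    by_cases hkj : k = j
    · subst hkj
      left
      refine ⟨i, k + 1, ?_⟩
      have h1 : step p ((Pi.single i 1 + Pi.single k 1 : Fin f → ℕ) k) = p - 1 := by
        simp [step, hki]
      rw [h1]
      linarith [pow_add_pow_mul hp k]
    · right
      have h1 : step p ((Pi.single i 1 + Pi.single j 1 : Fin f → ℕ) k) = 1 := by
        simp [step, hki, hkj]
      rw [h1, mul_one]
      rw [Fin.ext_iff] at hij hki hkj
      rcases lt_or_gt_of_ne hij with h1 | h1 <;> rcases lt_or_gt_of_ne hki with h2 | h2 <;>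
        rcases lt_or_gt_of_ne hkj with h3 | h3
      · exact ⟨k, i, j, h2, h1, j.2, by ring⟩
      · omega
      · exact ⟨i, k, j, h2, h3, j.2, by ring⟩
      · exact ⟨i, j, k, h1, h3, k.2, by ring⟩
      · exact ⟨k, j, i, h3, h1, i.2, by ring⟩
      · exact ⟨j, k, i, h3, h2, i.2, by ring⟩
      · omega
      · exact ⟨j, i, k, h1, h2, k.2, by ring⟩

variable (p f) in
/-- The number of multidegrees of given total degree and trivial weight. -/
noncomputable def weightCount (n : ℕ) : ℕ :=
  Nat.card {α : Multidegree f n // p ^ f - 1 ∣ weight p α.1}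

lemma weightCount_eq_card (n : ℕ) : weightCount p f n =
    (Finset.univ.filter fun a : Fin f → Fin (n + 1) => ∑ i, (a i : ℕ) = n ∧
      p ^ f - 1 ∣ weight p fun i => (a i : ℕ)).card := by
  rw [weightCount, ← Nat.subtype_card (p := fun a : Fin f → Fin (n + 1) => ∑ i, (a i : ℕ) = n ∧
    p ^ f - 1 ∣ weight p fun i => (a i : ℕ)) _ (by simp)]
  exact Nat.card_congr
    { toFun := fun α => ⟨fun i => ⟨α.1.1 i, Nat.lt_succ_of_le ((Finset.single_le_sum
        (fun j _ => Nat.zero_le (α.1.1 j)) (Finset.mem_univ i)).trans α.1.2.le)⟩, α.1.2, α.2⟩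
      invFun := fun a => ⟨⟨fun i => a.1 i, a.2.1⟩, a.2.2⟩
      left_inv := fun α => rfl
      right_inv := fun a => rfl }

lemma weightCount_eq_zero (n : ℕ) (h : ∀ α : Fin f → ℕ, ∑ i, α i = n → ¬ p ^ f - 1 ∣ weight p α) :
    weightCount p f n = 0 := by
  have : IsEmpty {α : Multidegree f n // p ^ f - 1 ∣ weight p α.1} := ⟨fun α => h _ α.1.2 α.2⟩
  exact Nat.card_of_isEmpty

lemma weightCount_one_eq_zero (hp : p.Prime) (hf : f ≠ 0) (h : 3 < p ^ f) :
    weightCount p f 1 = 0 := by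
  refine weightCount_eq_zero _ fun α hα hd => ?_
  obtain ⟨i, rfl⟩ := eq_single_of_sum_eq_one hα
  rw [weight_single hp.one_le] at hd
  exact h.not_ge (pow_le_three_of_dvd hp hf _ hd)

lemma weightCount_two_eq_zero (hp : p.Prime) (hf : f ≠ 0) (h : 6 < p ^ f) (h' : p ^ f ≠ 9) :
    weightCount p f 2 = 0 := by
  refine weightCount_eq_zero _ fun α hα hd => ?_
  obtain ⟨γ, j, hγ, rfl⟩ := exists_eq_single_add hα
  obtain ⟨i, rfl⟩ := eq_single_of_sum_eq_one hγ
  rw [weight_single_add_single hp.one_le] at hd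
  split_ifs at hd
  · have := pow_le_three_of_dvd hp hf _ hd
    omega
  · have := pow_le_six_of_dvd hp hf _ _ hd
    omega

lemma weightCount_three_eq_zero (hp : p.Prime) (hf : f ≠ 0) (h : 6 < p ^ f) (h' : p ^ f ≠ 9)
    (h8 : p ^ f ≠ 8) (h27 : p ^ f ≠ 27) : weightCount p f 3 = 0 := by
  refine weightCount_eq_zero _ fun α hα hd => ?_
  rcases exists_weight_eq_of_sum_eq_three hp.one_le hα with ⟨a, b, h1⟩ | ⟨a, b, c, hab, hbc, hc, h1⟩
  · rw [h1] at hd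
    have := pow_le_six_of_dvd hp hf _ _ hd
    omega
  · rw [h1] at hd
    have := pow_eq_of_dvd hp hab hbc hc hd
    omega

/-- The numbers of multidegrees of trivial weight for the exceptional fields. -/
lemma weightCount_exceptional :
    (weightCount 2 1 1 = 1 ∧ weightCount 2 1 2 = 1 ∧ weightCount 2 1 3 = 1) ∧
    (weightCount 3 1 1 = 1 ∧ weightCount 3 1 2 = 1 ∧ weightCount 3 1 3 = 1) ∧
    (weightCount 2 2 1 = 0 ∧ weightCount 2 2 2 = 1 ∧ weightCount 2 2 3 = 2) ∧
    (weightCount 3 2 1 = 0 ∧ weightCount 3 2 2 = 1 ∧ weightCount 3 2 3 = 2) ∧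
    (weightCount 5 1 1 = 0 ∧ weightCount 5 1 2 = 0 ∧ weightCount 5 1 3 = 1) ∧
    (weightCount 2 3 1 = 0 ∧ weightCount 2 3 2 = 0 ∧ weightCount 2 3 3 = 1) ∧
    (weightCount 3 3 1 = 0 ∧ weightCount 3 3 2 = 0 ∧ weightCount 3 3 3 = 1) := by
  simp only [weightCount_eq_card]
  decide +kernel

end Weights

/-! ### Trivial coefficients and universal coefficients -/

section Trivial
variable {G : Type} [Group G] {M N : Type} [AddCommGroup M] [AddCommGroup N]

/-- A homomorphism of abelian groups as a map of trivial representations. -/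
noncomputable def trivialMap (G : Type) [Group G] (u : M →+ N) :
    Rep.trivial ℤ G M ⟶ Rep.trivial ℤ G N := Rep.ofHom
  { toFun := u
    map_add' := map_add u
    map_smul' := fun r x => map_zsmul u r x
    isIntertwining' := fun g => by
      ext x
      rfl }

/-- Isomorphic abelian groups as isomorphic trivial representations. -/
noncomputable def trivialIso (G : Type) [Group G] (e : M ≃+ N) :
    Rep.trivial ℤ G M ≅ Rep.trivial ℤ G N where
  hom := trivialMap G e.toAddMonoidHom
  inv := trivialMap G e.symm.toAddMonoidHom
  hom_inv_id := by
    ext x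
    exact e.symm_apply_apply x
  inv_hom_id := by
    ext x
    exact e.apply_symm_apply x

/-- Homology with trivial coefficients commutes with finite powers of the coefficients. -/
lemma card_groupHomology_pi (ι : Type) [Fintype ι] [DecidableEq ι] (n : ℕ) :
    Nat.card (groupHomology (Rep.trivial ℤ G (ι → M)) n) =
      Nat.card (groupHomology (Rep.trivial ℤ G M) n) ^ Fintype.card ι := by
  let pr (i : ι) : Rep.trivial ℤ G (ι → M) ⟶ Rep.trivial ℤ G M := trivialMap G (Pi.evalAddMonoidHom _ i)
  let inc (i : ι) : Rep.trivial ℤ G M ⟶ Rep.trivial ℤ G (ι → M) :=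
    trivialMap G (AddMonoidHom.single (fun _ => M) i)
  have h1 : ∑ i, pr i ≫ inc i = 𝟙 (Rep.trivial ℤ G (ι → M)) := by
    have h2 : ∀ (s : Finset ι) (x : ι → M), (∑ i ∈ s, pr i ≫ inc i).hom x =
        ∑ i ∈ s, Pi.single i (x i) := fun s x => by
      induction s using Finset.induction_on with
      | empty => rfl
      | insert i s hi ih =>
        rw [Finset.sum_insert hi, Finset.sum_insert hi, ← ih]
        rfl
    exact Rep.hom_ext (DFunLike.ext _ _ fun x => (h2 _ x).trans (Finset.univ_sum_single x))
  have h2 : ∀ i, inc i ≫ pr i = 𝟙 _ := fun i => by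
    ext x
    exact Pi.single_eq_same (M := fun _ => M) i x
  have h3 : ∀ i j, i ≠ j → inc i ≫ pr j = 0 := fun i j hij => by
    ext x
    exact Pi.single_eq_of_ne (M := fun _ => M) hij.symm x
  let e : groupHomology (Rep.trivial ℤ G (ι → M)) n ≃ (ι → groupHomology (Rep.trivial ℤ G M) n) :=
    { toFun := fun x i => hmap (pr i) n x
      invFun := fun y => ∑ i, hmap (inc i) n (y i)
      left_inv := fun x => by
        simp only [← hmap_comp]
        rw [← LinearMap.sum_apply, ← hmap_sum, h1, hmap_id]
      right_inv := fun y => by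
        funext j
        simp only [map_sum, ← hmap_comp]
        rw [Finset.sum_eq_single j]
        · rw [h2, hmap_id]
        · intro i _ hij
          rw [h3 i j hij, hmap_zero]
          rfl
        · simp }
  rw [Nat.card_congr e, Nat.card_fun, Nat.card_eq_fintype_card (α := ι)]

/-- H₀(G, ℤ) embeds in ℤ. This starts the recursion for the orders of the p-parts. -/
lemma eq_zero_of_nsmul_eq_zero {m : ℕ} (hm : m ≠ 0) (x : integralHomology G 0) (h : m • x = 0) :
    x = 0 := by
  let σ : (Rep.trivial ℤ G ℤ).ρ.Coinvariants →ₗ[ℤ] ℤ :=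
    Representation.Coinvariants.lift (Rep.trivial ℤ G ℤ).ρ LinearMap.id fun g => rfl
  have hσ : Function.Injective σ := by
    rw [injective_iff_map_eq_zero]
    intro y hy
    induction y using Representation.Coinvariants.induction_on with | _ z
    have hz : z = 0 := hy
    rw [hz, map_zero]
  apply (zeroEquiv _).injective
  apply hσ
  have h1 : m • σ (zeroEquiv _ x) = 0 := by
    rw [← map_nsmul, ← map_nsmul, h, map_zero, map_zero]
  rw [map_zero, map_zero]
  exact (smul_eq_zero.1 h1).resolve_left hm

/-- The universal coefficient count for coefficients modulo `p`. -/
lemma card_groupHomology_zmod (p : ℕ) (hp : p ≠ 0) (n : ℕ) :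
    Nat.card (groupHomology (Rep.trivial ℤ G (ZMod p)) (n + 1)) =
      Nat.card (integralHomology G (n + 1) ⧸
        (nsmulAddMonoidHom p : integralHomology G (n + 1) →+ integralHomology G (n + 1)).range) *
      Nat.card (nsmulAddMonoidHom p : integralHomology G n →+ integralHomology G n).ker := by
  have hφ : ∀ x, (trivialMap G (nsmulAddMonoidHom p : ℤ →+ ℤ)).hom x = p • x := fun x => rfl
  have hφn : ∀ n, hmap (trivialMap G (nsmulAddMonoidHom p : ℤ →+ ℤ)) n =
      p • (LinearMap.id : integralHomology G n →ₗ[ℤ] integralHomology G n) := fun n => by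
    have h1 : trivialMap G (nsmulAddMonoidHom p : ℤ →+ ℤ) = p • 𝟙 (Rep.trivial ℤ G ℤ) :=
      Rep.hom_ext (DFunLike.ext _ _ fun x => hφ x)
    rw [h1, hmap_nsmul]
    congr 1
    ext x
    exact hmap_id n x
  obtain ⟨δ, h1, h2, h3⟩ := exists_longExact (trivialMap G (nsmulAddMonoidHom p : ℤ →+ ℤ))
    (trivialMap G (Int.castAddHom (ZMod p))) (fun x y h => by
      have h' : p • (x : ℤ) = p • (y : ℤ) := h
      exact smul_right_injective ℤ hp h') ZMod.intCast_surjective fun b => by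
      change ((b : ℤ) : ZMod p) = 0 ↔ ∃ a : ℤ, p • a = b
      rw [ZMod.intCast_zmod_eq_zero_iff_dvd]
      simp only [nsmul_eq_mul]
      exact ⟨fun ⟨a, ha⟩ => ⟨a, ha.symm⟩, fun ⟨a, ha⟩ => ⟨a, ha.symm⟩⟩
  set ψ := hmap (trivialMap G (Int.castAddHom (ZMod p))) (n + 1)
  rw [AddSubgroup.card_eq_card_quotient_mul_card_addSubgroup (δ n).toAddMonoidHom.ker, mul_comm]
  congr 1
  · have hr : ψ.toAddMonoidHom.ker = (nsmulAddMonoidHom p :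
        integralHomology G (n + 1) →+ integralHomology G (n + 1)).range := by
      ext x
      refine (h1 (n + 1) x).trans ?_
      rw [hφn]
      rfl
    have hk : ψ.toAddMonoidHom.range = (δ n).toAddMonoidHom.ker := by
      ext x
      exact (h2 n x).symm
    rw [← hr, ← hk]
    exact (Nat.card_congr (QuotientAddGroup.quotientKerEquivRange ψ.toAddMonoidHom).toEquiv).symm
  · have hk : (δ n).toAddMonoidHom.range =
        (nsmulAddMonoidHom p : integralHomology G n →+ integralHomology G n).ker := by
      ext x
      refine (h3 n x).symm.trans ?_
      rw [hφn]
      rfl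
    rw [← hk]
    exact Nat.card_congr (QuotientAddGroup.quotientKerEquivRange (δ n).toAddMonoidHom).toEquiv

end Trivial

/-! ### Orders of the p-parts and conclusion -/

section PPart
variable {F : Type} [Field F] [Finite F] {p f : ℕ} [Fact p.Prime] [CharP F p]

lemma mem_homologySL2PPart (n : ℕ) (x : integralHomology (SL2 F) n) :
    x ∈ homologySL2PPart p F n ↔ p • x = 0 := by
  cases n with
  | zero =>
    have hp : p ≠ 0 := (Fact.out : p.Prime).ne_zero
    refine ⟨fun ⟨k, hk⟩ => ?_, fun h => ⟨1, by simpa using h⟩⟩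
    rw [eq_zero_of_nsmul_eq_zero (pow_ne_zero k hp) x hk, smul_zero]
  | succ n =>
    exact mem_primaryComponent_iff (coprime_index_unipotent p)
      (index_unipotent_mul_nsmul_eq_zero p n) x

lemma homologySL2PPart_zero : homologySL2PPart p F 0 = ⊥ := by
  rw [eq_bot_iff]
  intro x hx
  exact eq_zero_of_nsmul_eq_zero (Fact.out : p.Prime).ne_zero x ((mem_homologySL2PPart 0 x).1 hx)

/-- Consecutive `p`-parts have orders whose product counts multidegrees of trivial weight. -/
theorem card_homologySL2PPart_mul (hF : Nat.card F = p ^ f) (hf : f ≠ 0) (n : ℕ) :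
    Nat.card (homologySL2PPart p F (n + 1)) * Nat.card (homologySL2PPart p F n) =
      p ^ weightCount p f (n + 1) := by
  have := Fintype.ofFinite F
  let _ := ZMod.algebra F p
  have hp : p.Prime := Fact.out
  have hF' : Fintype.card F = p ^ f := by rw [← Nat.card_eq_fintype_card, hF]
  have hfin : Module.finrank (ZMod p) F = f := by
    have h1 := Module.card_eq_pow_finrank (K := ZMod p) (V := F)
    rw [hF', ZMod.card] at h1
    exact (Nat.pow_right_injective hp.two_le h1).symm
  have e : F ≃+ (Fin f → ZMod p) :=
    ((Module.finBasis (ZMod p) F).reindex (finCongr hfin)).equivFun.toAddEquiv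
  have h1 : Nat.card (homologySL2PPart p F (n + 1)) * Nat.card (homologySL2PPart p F n) =
      Nat.card (groupHomology (Rep.trivial ℤ (SL2 F) (ZMod p)) (n + 1)) := by
    rw [card_groupHomology_zmod p hp.ne_zero,
      card_quotient_eq_card_primaryComponent (coprime_index_unipotent p)
      (index_unipotent_mul_nsmul_eq_zero p n)]
    congr 2
    have : homologySL2PPart p F n =
        (nsmulAddMonoidHom p : integralHomology (SL2 F) n →+ integralHomology (SL2 F) n).ker := by
      ext x
      exact mem_homologySL2PPart n x
    rw [this]
  have h2 := card_groupHomology_borel (F := F) hF' n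
  -- Passing from `F` to (ℤ/p)^f makes both sides f-th powers, and the f-th root is then taken.
  rw [← Nat.card_congr (borelEquiv F n).toEquiv,
    Nat.card_congr (hmapEquiv (trivialIso (SL2 F) e) (n + 1)).toEquiv, card_groupHomology_pi, ← h1,
    Fintype.card_fin, hF', ← pow_mul, mul_comm f, pow_mul] at h2
  exact Nat.pow_left_injective hf h2

end PPart

/-- The numbers of multidegrees of trivial weight in low degrees. -/
lemma weightCount_cases {p f : ℕ} (hp : p.Prime) (hf : f ≠ 0) :
    let N := weightCount p f
    ((p ^ f = 2 ∨ p ^ f = 3) ∧ N 1 = 1 ∧ N 2 = 1 ∧ N 3 = 1) ∨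
    ((p ^ f = 4 ∨ p ^ f = 9) ∧ N 1 = 0 ∧ N 2 = 1 ∧ N 3 = 2) ∨
    ((p ^ f = 5 ∨ p ^ f = 8 ∨ p ^ f = 27) ∧ N 1 = 0 ∧ N 2 = 0 ∧ N 3 = 1) ∨
    ((3 < p ^ f ∧ p ^ f ≠ 4 ∧ p ^ f ≠ 9 ∧ p ^ f ≠ 5 ∧ p ^ f ≠ 8 ∧ p ^ f ≠ 27) ∧
      N 1 = 0 ∧ N 2 = 0 ∧ N 3 = 0) := by
  obtain ⟨h2, h3, h4, h9, h5, h8, h27⟩ := weightCount_exceptional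
  have key : ∀ r m, r.Prime → m ≠ 0 → p ^ f = r ^ m → p = r ∧ f = m := fun r m hr hm h => by
    obtain ⟨f, rfl⟩ := Nat.exists_eq_succ_of_ne_zero hf
    obtain ⟨m, rfl⟩ := Nat.exists_eq_succ_of_ne_zero hm
    obtain ⟨h1, h2⟩ := Nat.Prime.pow_inj hp hr h
    exact ⟨h1, by rw [h2]⟩
  have hone : 1 < p ^ f := Nat.one_lt_pow hf hp.one_lt
  by_cases q2 : p ^ f = 2
  · obtain ⟨rfl, rfl⟩ := key 2 1 Nat.prime_two one_ne_zero q2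
    exact Or.inl ⟨Or.inl rfl, h2⟩
  by_cases q3 : p ^ f = 3
  · obtain ⟨rfl, rfl⟩ := key 3 1 Nat.prime_three one_ne_zero q3
    exact Or.inl ⟨Or.inr rfl, h3⟩
  by_cases q4 : p ^ f = 4
  · obtain ⟨rfl, rfl⟩ := key 2 2 Nat.prime_two two_ne_zero q4
    exact Or.inr (Or.inl ⟨Or.inl rfl, h4⟩)
  by_cases q9 : p ^ f = 9
  · obtain ⟨rfl, rfl⟩ := key 3 2 Nat.prime_three two_ne_zero q9
    exact Or.inr (Or.inl ⟨Or.inr rfl, h9⟩)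
  by_cases q5 : p ^ f = 5
  · obtain ⟨rfl, rfl⟩ := key 5 1 Nat.prime_five one_ne_zero q5
    exact Or.inr (Or.inr (Or.inl ⟨Or.inl rfl, h5⟩))
  by_cases q8 : p ^ f = 8
  · obtain ⟨rfl, rfl⟩ := key 2 3 Nat.prime_two three_ne_zero q8
    exact Or.inr (Or.inr (Or.inl ⟨Or.inr (Or.inl rfl), h8⟩))
  by_cases q27 : p ^ f = 27
  · obtain ⟨rfl, rfl⟩ := key 3 3 Nat.prime_three three_ne_zero q27
    exact Or.inr (Or.inr (Or.inl ⟨Or.inr (Or.inr rfl), h27⟩))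
  -- The size bounds leave 6 open, but it is not a prime power.
  have q6 : p ^ f ≠ 6 := fun h => by
    have hd2 : 2 ∣ p ^ f := by rw [h]; decide
    have hd3 : 3 ∣ p ^ f := by rw [h]; decide
    have e2 := (Nat.prime_dvd_prime_iff_eq Nat.prime_two hp).1 (Nat.prime_two.dvd_of_dvd_pow hd2)
    have e3 := (Nat.prime_dvd_prime_iff_eq Nat.prime_three hp).1 (Nat.prime_three.dvd_of_dvd_pow hd3)
    omega
  exact Or.inr (Or.inr (Or.inr ⟨by omega, weightCount_one_eq_zero hp hf (by omega),
    weightCount_two_eq_zero hp hf (by omega) q9,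
    weightCount_three_eq_zero hp hf (by omega) q9 q8 q27⟩))

/-- Consecutive products determine the orders of the `p`-parts in degrees at most three. -/
lemma eq_of_mul_eq_pow {p q k : ℕ} {c N : ℕ → ℕ} (hp : 0 < p) (hc0 : c 0 = 1)
    (hc : ∀ n, c (n + 1) * c n = p ^ N (n + 1))
    (h : ((q = 2 ∨ q = 3) ∧ N 1 = 1 ∧ N 2 = 1 ∧ N 3 = 1) ∨
      ((q = 4 ∨ q = 9) ∧ N 1 = 0 ∧ N 2 = 1 ∧ N 3 = 2) ∨
      ((q = 5 ∨ q = 8 ∨ q = 27) ∧ N 1 = 0 ∧ N 2 = 0 ∧ N 3 = 1) ∨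
      ((3 < q ∧ q ≠ 4 ∧ q ≠ 9 ∧ q ≠ 5 ∧ q ≠ 8 ∧ q ≠ 27) ∧ N 1 = 0 ∧ N 2 = 0 ∧ N 3 = 0))
    (hk : k ≤ 3) : ((k, q) ∈ exceptionalPairs → c k = p) ∧ ((k, q) ∉ exceptionalPairs → c k = 1) := by
  have hc1 := hc 0
  have hc2 := hc 1
  have hc3 := hc 2
  simp only [zero_add, Nat.reduceAdd, hc0, mul_one] at hc1 hc2 hc3
  simp only [exceptionalPairs, Finset.mem_insert, Finset.mem_singleton, Prod.mk.injEq]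
  rcases h with ⟨hq, h1, h2, h3⟩ | ⟨hq, h1, h2, h3⟩ | ⟨hq, h1, h2, h3⟩ | ⟨hq, h1, h2, h3⟩
  · rw [h1, pow_one] at hc1
    rw [h2, hc1, pow_one] at hc2
    replace hc2 := Nat.eq_of_mul_eq_mul_right hp (hc2.trans (one_mul p).symm)
    rw [h3, hc2, pow_one, mul_one] at hc3
    clear hc h1 h2 h3
    interval_cases k <;> simp [hc0, hc1, hc2, hc3] <;> omega
  · rw [h1, pow_zero] at hc1
    rw [h2, hc1, pow_one, mul_one] at hc2
    rw [h3, hc2, pow_two] at hc3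
    replace hc3 := Nat.eq_of_mul_eq_mul_right hp hc3
    clear hc h1 h2 h3
    interval_cases k <;> simp [hc0, hc1, hc2, hc3] <;> omega
  · rw [h1, pow_zero] at hc1
    rw [h2, hc1, pow_zero, mul_one] at hc2
    rw [h3, hc2, pow_one, mul_one] at hc3
    clear hc h1 h2 h3
    interval_cases k <;> simp [hc0, hc1, hc2, hc3] <;> omega
  · rw [h1, pow_zero] at hc1
    rw [h2, hc1, pow_zero, mul_one] at hc2
    rw [h3, hc2, pow_zero, mul_one] at hc3
    clear hc h1 h2 h3
    interval_cases k <;> simp [hc0, hc1, hc2, hc3] <;> omega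

end GroupHomologyZ

theorem lemma3 (p : ℕ) [Fact p.Prime] (F : Type) [Field F] [Finite F] [CharP F p]
    (k : ℕ) (hk : k ≤ 3) :
    ((k, Nat.card F) ∈ exceptionalPairs →
      Nonempty (homologySL2PPart p F k ≃+ ZMod p)) ∧
    ((k, Nat.card F) ∉ exceptionalPairs → homologySL2PPart p F k = ⊥) := by
  have := Fintype.ofFinite F
  have hp : p.Prime := Fact.out
  obtain ⟨f, -, hF⟩ := FiniteField.card F p
  have hf : (f : ℕ) ≠ 0 := f.ne_zero
  rw [← Nat.card_eq_fintype_card] at hF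
  have hc0 : Nat.card (homologySL2PPart p F 0) = 1 :=
    (AddSubgroup.eq_bot_iff_card _).1 GroupHomologyZ.homologySL2PPart_zero
  have hcases := GroupHomologyZ.weightCount_cases hp hf
  rw [← hF] at hcases
  obtain ⟨h1, h2⟩ := GroupHomologyZ.eq_of_mul_eq_pow
    (c := fun n => Nat.card (homologySL2PPart p F n)) hp.pos hc0
    (GroupHomologyZ.card_homologySL2PPart_mul hF hf) hcases hk
  refine ⟨fun h => ?_, fun h => (AddSubgroup.eq_bot_iff_card _).2 (h2 h)⟩
  have hcard : Nat.card (homologySL2PPart p F k) = p := h1 h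
  have := isAddCyclic_of_prime_card hcard
  exact ⟨((ZMod.ringEquivCongr hcard).toAddEquiv.symm.trans (zmodAddCyclicAddEquiv this)).symm⟩
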